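/- For a bounded linear map $\theta\colon E\to F$ between $C^*$-algebras, say that $\theta$ preserves - *zero-products* if $xy=0$ implies $\theta(x)\theta(y)=0$; - *range-orthogonality* if $x^*y=0$ implies $\theta(x)^*\theta(y)=0$; - *domain-orthogonality* if $xy^*=0$ implies $\theta(x)\theta(y)^*=0$; - *zero-TRO-products* if $xy^*z=0$ implies $\theta(x)\theta(y)^*\theta(z)=0$; where $x,y,z$ range over $E$. **Proposition.** Let $A,B,C,D$ be (not necessarily unital) $C^*$-algebras, let $\varphi\colon A\to B$ and $\psi\colon C\to D$ be bounded linear maps, and let $\otimes$ denote the minimal tensor product of $C^*$-algebras. A tensor product map of $\varphi$ and $\psi$ is a bounded linear map $\varphi\otimes\psi\colon A\otimes C\to B\otimes D$ with $(\varphi\otimes\psi)(a\otimes c)=\varphi(a)\otimes\psi(c)$ for all $a\in A$, $c\in C$; there is at most one. 1. If $\varphi$ and $\psi$ preserve zero-products and the tensor product map $\varphi\otimes\psi$ exists (that is, $a\otimes c\mapsto\varphi(a)\otimes\psi(c)$ extends to a bounded linear map $A\otimes C\to B\otimes D$), then $\varphi\otimes\psi$ preserves zero-products. 2. If $\varphi$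 and $\psi$ both preserve range-orthogonality, then the tensor product map $\varphi\otimes\psi$ exists, is unique, and preserves range-orthogonality. 3. If $\varphi$ and $\psi$ both preserve domain-orthogonality, then the tensor product map $\varphi\otimes\psi$ exists, is unique, and preserves domain-orthogonality. 4. If $\varphi$ and $\psi$ both preserve zero-TRO-products, then the tensor product map $\varphi\otimes\psi$ exists, is unique, and preserves zero-TRO-products. The same four statements hold with the maximal tensor product in place of the minimal tensor product throughout. -/

import Mathlib

open scoped TensorProduct

universe u v

noncomputable section

/-! ### Orthogonality preservers -/

section Preservers

variable {A : Type u} {B : Type v} [NonUnitalCStarAlgebra A] [NonUnitalCStarAlgebra B]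

/-- `φ` preserves zero-products: `a b = 0` implies `φ(a) φ(b) = 0`. -/
def PreservesZeroProducts (φ : A →L[ℂ] B) : Prop :=
  ∀ a b : A, a * b = 0 → φ a * φ b = 0

/-- `φ` preserves range-orthogonality: `a⋆ b = 0` implies `φ(a)⋆ φ(b) = 0`. -/
def PreservesRangeOrthogonality (φ : A →L[ℂ] B) : Prop :=
  ∀ a b : A, star a * b = 0 → star (φ a) * φ b = 0

/-- `φ` preserves domain-orthogonality: `a b⋆ = 0` implies `φ(a) φ(b)⋆ = 0`. -/
def PreservesDomainOrthogonality (φ : A →L[ℂ] B) : Prop :=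
  ∀ a b : A, a * star b = 0 → φ a * star (φ b) = 0

/-- `φ` preserves zero-TRO-products: `a b⋆ c = 0` implies `φ(a) φ(b)⋆ φ(c) = 0`. -/
def PreservesZeroTROProducts (φ : A →L[ℂ] B) : Prop :=
  ∀ a b c : A, a * star b * c = 0 → φ a * star (φ b) * φ c = 0

end Preservers

/-! ### C⋆-seminorms and the associated C⋆-algebra -/

/-- A C⋆-seminorm on a complex ⋆-algebra `T`: a submultiplicative seminorm with
`p (x⋆ x) = p (x) ^ 2`. -/
structure CStarSeminorm (T : Type u) [NonUnitalRing T] [StarRing T] [Module ℂ T]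
    extends Seminorm ℂ T where
  mul_le : ∀ x y : T, toFun (x * y) ≤ toFun x * toFun y
  star_mul_self : ∀ x : T, toFun (star x * x) = toFun x ^ 2

namespace CStarSeminorm

variable {T : Type u} [NonUnitalRing T] [StarRing T] [Module ℂ T]

instance : CoeFun (CStarSeminorm T) (fun _ => T → ℝ) := ⟨fun p => p.toFun⟩

theorem nonneg (p : CStarSeminorm T) (x : T) : 0 ≤ p x := apply_nonneg p.toSeminorm x

theorem add_le (p : CStarSeminorm T) (x y : T) : p (x + y) ≤ p x + p y :=
  map_add_le_add p.toSeminorm x y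

theorem le_star (p : CStarSeminorm T) (x : T) : p x ≤ p (star x) := by
  have h := p.star_mul_self x
  have h2 := p.mul_le (star x) x
  have h3 := p.nonneg x
  have h4 := p.nonneg (star x)
  by_contra hc
  push Not at hc
  nlinarith

theorem map_star (p : CStarSeminorm T) (x : T) : p (star x) = p x :=
  le_antisymm (by simpa using p.le_star (star x)) (p.le_star x)

theorem neg_add_self (p : CStarSeminorm T) (x : T) : p (-x + x) = 0 := by
  rw [neg_add_cancel]
  exact map_zero p.toSeminorm

theorem neg_add_comm (p : CStarSeminorm T) (x y : T) : p (-x + y) = p (-y + x) := by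
  have h : p (-(-x + y)) = p (-x + y) := map_neg_eq_map p.toSeminorm (-x + y)
  rw [← h, neg_add_rev, neg_neg]

theorem neg_add_triangle (p : CStarSeminorm T) (x y z : T) :
    p (-x + z) ≤ p (-x + y) + p (-y + z) := by
  have h := p.add_le (-x + y) (-y + z)
  rwa [add_assoc, add_neg_cancel_left] at h

/-- The algebra `T`, regarded as a seminormed space by means of `p`. -/
def Pre (_p : CStarSeminorm T) : Type u := T

variable (p : CStarSeminorm T)

instance : NonUnitalRing p.Pre := inferInstanceAs (NonUnitalRing T)

instance : NonUnitalSeminormedRing p.Pre where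
  __ := (inferInstance : NonUnitalRing p.Pre)
  norm x := p x
  dist x y := p (-x + y)
  dist_self x := p.neg_add_self x
  dist_comm x y := p.neg_add_comm x y
  dist_triangle x y z := p.neg_add_triangle x y z
  dist_eq _ _ := rfl
  norm_mul_le x y := p.mul_le x y

theorem norm_pre (x : p.Pre) : ‖x‖ = p x := rfl

instance : StarRing p.Pre := inferInstanceAs (StarRing T)
instance : Module ℂ p.Pre := inferInstanceAs (Module ℂ T)

instance : NormedSpace ℂ p.Pre where
  norm_smul_le c x := (map_smul_eq_mul p.toSeminorm c x).le

instance [IsScalarTower ℂ T T] : IsScalarTower ℂ p.Pre p.Pre :=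
  inferInstanceAs (IsScalarTower ℂ T T)
instance [SMulCommClass ℂ T T] : SMulCommClass ℂ p.Pre p.Pre :=
  inferInstanceAs (SMulCommClass ℂ T T)
instance [StarModule ℂ T] : StarModule ℂ p.Pre := inferInstanceAs (StarModule ℂ T)

instance : NormedStarGroup p.Pre where
  norm_star_le x := (p.map_star x).le

/-- The Hausdorff completion of `T` with respect to the C⋆-seminorm `p`
(in it, the elements `x` with `p x = 0` become zero). -/
def Alg : Type u := UniformSpace.Completion p.Pre

instance : NormedAddCommGroup p.Alg :=
  inferInstanceAs (NormedAddCommGroup (UniformSpace.Completion p.Pre))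
instance : NormedSpace ℂ p.Alg :=
  inferInstanceAs (NormedSpace ℂ (UniformSpace.Completion p.Pre))
instance : CompleteSpace p.Alg :=
  inferInstanceAs (CompleteSpace (UniformSpace.Completion p.Pre))

/-- The canonical map from `T` to the completion. -/
def toAlg (x : T) : p.Alg := UniformSpace.Completion.coe' (α := p.Pre) x

theorem norm_toAlg (x : T) : ‖p.toAlg x‖ = p x :=
  UniformSpace.Completion.norm_coe (E := p.Pre) x

theorem toAlg_add (x y : T) : p.toAlg (x + y) = p.toAlg x + p.toAlg y :=
  UniformSpace.Completion.coe_add (α := p.Pre) x y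

theorem toAlg_zero : p.toAlg 0 = 0 := UniformSpace.Completion.coe_zero (α := p.Pre)

theorem toAlg_smul (c : ℂ) (x : T) : p.toAlg (c • x) = c • p.toAlg x :=
  UniformSpace.Completion.coe_smul (X := p.Pre) c x

theorem isDenseInducing_toAlg : IsDenseInducing (fun x : p.Pre => p.toAlg x) :=
  UniformSpace.Completion.isDenseInducing_coe

theorem continuous_toAlg : Continuous (fun x : p.Pre => p.toAlg x) :=
  p.isDenseInducing_toAlg.continuous

@[elab_as_elim]
theorem alg_induction {P : p.Alg → Prop} (x : p.Alg) (hP : IsClosed {x | P x})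
    (h : ∀ x : T, P (p.toAlg x)) : P x :=
  UniformSpace.Completion.induction_on x hP h

/-- The product of the completion: the continuous extension of the product of `T`. -/
instance : Mul p.Alg :=
  ⟨fun x y => (p.isDenseInducing_toAlg.prodMap p.isDenseInducing_toAlg).extend
    (fun z : p.Pre × p.Pre => p.toAlg (z.1 * z.2)) (x, y)⟩

theorem toAlg_mul (x y : T) : p.toAlg (x * y) = p.toAlg x * p.toAlg y :=
  ((p.isDenseInducing_toAlg.prodMap p.isDenseInducing_toAlg).extend_eq
    (p.continuous_toAlg.comp continuous_mul) (x, y)).symm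

instance : ContinuousMul p.Alg where
  continuous_mul := by
    let m : p.Pre →+ p.Pre →+ p.Alg :=
      (AddMonoidHom.mul : p.Pre →+ p.Pre →+ p.Pre).compr₂
        (UniformSpace.Completion.toCompl : p.Pre →+ UniformSpace.Completion p.Pre)
    have hm : Continuous fun z : p.Pre × p.Pre => m z.1 z.2 :=
      p.continuous_toAlg.comp continuous_mul
    have di : IsDenseInducing
        (UniformSpace.Completion.toCompl : p.Pre →+ UniformSpace.Completion p.Pre) :=
      UniformSpace.Completion.isDenseInducing_coe
    exact (di.extend_Z_bilin di hm :)

/-- The involution of the completion: the continuous extension of the involution of `T`. -/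
instance : Star p.Alg :=
  ⟨(UniformSpace.Completion.map (fun x : p.Pre => star x) :
    UniformSpace.Completion p.Pre → UniformSpace.Completion p.Pre)⟩

theorem toAlg_star (x : T) : p.toAlg (star x) = star (p.toAlg x) :=
  (UniformSpace.Completion.map_coe
    (starNormedAddGroupHom (E := p.Pre)).uniformContinuous x).symm

theorem continuous_alg_star : Continuous (fun x : p.Alg => star x) :=
  UniformSpace.Completion.continuous_map

theorem alg_zero_mul (a : p.Alg) : 0 * a = 0 := by
  refine p.alg_induction a (isClosed_eq (continuous_const.mul continuous_id) continuous_const) ?_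
  intro a
  rw [← toAlg_zero, ← toAlg_mul, zero_mul]

theorem alg_mul_zero (a : p.Alg) : a * 0 = 0 := by
  refine p.alg_induction a (isClosed_eq (continuous_id.mul continuous_const) continuous_const) ?_
  intro a
  rw [← toAlg_zero, ← toAlg_mul, mul_zero]

theorem continuous_mul_right (c : p.Alg) : Continuous fun x : p.Alg => x * c :=
  continuous_id.mul continuous_const

theorem continuous_mul_left (c : p.Alg) : Continuous fun x : p.Alg => c * x :=
  continuous_const.mul continuous_id

theorem continuous_add_right (c : p.Alg) : Continuous fun x : p.Alg => x + c :=
  continuous_id.add continuous_const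

theorem continuous_add_left (c : p.Alg) : Continuous fun x : p.Alg => c + x :=
  continuous_const.add continuous_id

theorem alg_mul_assoc (a b c : p.Alg) : a * b * c = a * (b * c) := by
  refine p.alg_induction a (isClosed_eq
    ((p.continuous_mul_right c).comp (p.continuous_mul_right b))
    (p.continuous_mul_right (b * c))) fun a => ?_
  refine p.alg_induction b (isClosed_eq
    ((p.continuous_mul_right c).comp (p.continuous_mul_left (p.toAlg a)))
    ((p.continuous_mul_left (p.toAlg a)).comp (p.continuous_mul_right c))) fun b => ?_
  refine p.alg_induction c (isClosed_eq
    (p.continuous_mul_left (p.toAlg a * p.toAlg b))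
    ((p.continuous_mul_left (p.toAlg a)).comp (p.continuous_mul_left (p.toAlg b)))) fun c => ?_
  simp only [← toAlg_mul, mul_assoc]

theorem alg_mul_add (a b c : p.Alg) : a * (b + c) = a * b + a * c := by
  refine p.alg_induction a (isClosed_eq
    (p.continuous_mul_right (b + c))
    ((p.continuous_mul_right b).add (p.continuous_mul_right c))) fun a => ?_
  refine p.alg_induction b (isClosed_eq
    ((p.continuous_mul_left (p.toAlg a)).comp (p.continuous_add_right c))
    ((p.continuous_mul_left (p.toAlg a)).add continuous_const)) fun b => ?_
  refine p.alg_induction c (isClosed_eq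
    ((p.continuous_mul_left (p.toAlg a)).comp (p.continuous_add_left (p.toAlg b)))
    (continuous_const.add (p.continuous_mul_left (p.toAlg a)))) fun c => ?_
  simp only [← toAlg_mul, ← toAlg_add, mul_add]

theorem alg_add_mul (a b c : p.Alg) : (a + b) * c = a * c + b * c := by
  refine p.alg_induction a (isClosed_eq
    ((p.continuous_mul_right c).comp (p.continuous_add_right b))
    ((p.continuous_mul_right c).add continuous_const)) fun a => ?_
  refine p.alg_induction b (isClosed_eq
    ((p.continuous_mul_right c).comp (p.continuous_add_left (p.toAlg a)))
    (continuous_const.add (p.continuous_mul_right c))) fun b => ?_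
  refine p.alg_induction c (isClosed_eq
    (p.continuous_mul_left (p.toAlg a + p.toAlg b))
    ((p.continuous_mul_left (p.toAlg a)).add (p.continuous_mul_left (p.toAlg b)))) fun c => ?_
  simp only [← toAlg_mul, ← toAlg_add, add_mul]

instance : NonUnitalRing p.Alg where
  __ := (inferInstance : AddCommGroup p.Alg)
  __ := (inferInstance : Mul p.Alg)
  zero_mul := p.alg_zero_mul
  mul_zero := p.alg_mul_zero
  mul_assoc := p.alg_mul_assoc
  left_distrib := p.alg_mul_add
  right_distrib := p.alg_add_mul

theorem alg_star_star (a : p.Alg) : star (star a) = a := by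
  refine p.alg_induction a (isClosed_eq
    (p.continuous_alg_star.comp p.continuous_alg_star) continuous_id) fun a => ?_
  rw [← toAlg_star, ← toAlg_star, star_star]

theorem alg_star_add (a b : p.Alg) : star (a + b) = star a + star b := by
  refine p.alg_induction a (isClosed_eq
    (p.continuous_alg_star.comp (p.continuous_add_right b))
    (p.continuous_alg_star.add continuous_const)) fun a => ?_
  refine p.alg_induction b (isClosed_eq
    (p.continuous_alg_star.comp (p.continuous_add_left (p.toAlg a)))
    (continuous_const.add p.continuous_alg_star)) fun b => ?_
  simp only [← toAlg_add, ← toAlg_star, star_add]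

theorem alg_star_mul (a b : p.Alg) : star (a * b) = star b * star a := by
  refine p.alg_induction a (isClosed_eq
    (p.continuous_alg_star.comp (p.continuous_mul_right b))
    ((p.continuous_mul_left (star b)).comp p.continuous_alg_star)) fun a => ?_
  refine p.alg_induction b (isClosed_eq
    (p.continuous_alg_star.comp (p.continuous_mul_left (p.toAlg a)))
    ((p.continuous_mul_right (star (p.toAlg a))).comp p.continuous_alg_star)) fun b => ?_
  simp only [← toAlg_mul, ← toAlg_star, star_mul]

instance : StarRing p.Alg where
  star_involutive := p.alg_star_star
  star_add := p.alg_star_add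
  star_mul := p.alg_star_mul

theorem alg_norm_mul_le (a b : p.Alg) : ‖a * b‖ ≤ ‖a‖ * ‖b‖ := by
  refine p.alg_induction a (isClosed_le
    (p.continuous_mul_right b).norm (continuous_norm.mul continuous_const)) fun a => ?_
  refine p.alg_induction b (isClosed_le
    (p.continuous_mul_left (p.toAlg a)).norm (continuous_const.mul continuous_norm)) fun b => ?_
  rw [← toAlg_mul, norm_toAlg, norm_toAlg, norm_toAlg]
  exact p.mul_le a b

theorem alg_norm_mul_self_le (a : p.Alg) : ‖a‖ * ‖a‖ ≤ ‖star a * a‖ := by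
  refine p.alg_induction a (isClosed_le
    (continuous_norm.mul continuous_norm)
    (p.continuous_alg_star.mul continuous_id).norm) fun a => ?_
  rw [← toAlg_star, ← toAlg_mul, norm_toAlg, norm_toAlg, ← pow_two]
  exact (p.star_mul_self a).ge

theorem alg_smul_mul [IsScalarTower ℂ T T] (c : ℂ) (a b : p.Alg) : (c • a) * b = c • (a * b) := by
  refine p.alg_induction a (isClosed_eq
    ((p.continuous_mul_right b).comp (continuous_const_smul c))
    ((continuous_const_smul c).comp (p.continuous_mul_right b))) fun a => ?_
  refine p.alg_induction b (isClosed_eq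
    (p.continuous_mul_left (c • p.toAlg a))
    ((continuous_const_smul c).comp (p.continuous_mul_left (p.toAlg a)))) fun b => ?_
  simp only [← toAlg_mul, ← toAlg_smul, smul_mul_assoc]

theorem alg_mul_smul [SMulCommClass ℂ T T] (c : ℂ) (a b : p.Alg) : a * (c • b) = c • (a * b) := by
  refine p.alg_induction a (isClosed_eq
    (p.continuous_mul_right (c • b))
    ((continuous_const_smul c).comp (p.continuous_mul_right b))) fun a => ?_
  refine p.alg_induction b (isClosed_eq
    ((p.continuous_mul_left (p.toAlg a)).comp (continuous_const_smul c))
    ((continuous_const_smul c).comp (p.continuous_mul_left (p.toAlg a)))) fun b => ?_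
  simp only [← toAlg_mul, ← toAlg_smul, mul_smul_comm]

theorem alg_star_smul [StarModule ℂ T] (c : ℂ) (a : p.Alg) : star (c • a) = star c • star a := by
  refine p.alg_induction a (isClosed_eq
    (p.continuous_alg_star.comp (continuous_const_smul c))
    ((continuous_const_smul (star c)).comp p.continuous_alg_star)) fun a => ?_
  rw [← toAlg_star, ← toAlg_smul, ← toAlg_smul, ← toAlg_star, star_smul]

variable [IsScalarTower ℂ T T] [SMulCommClass ℂ T T] [StarModule ℂ T]

/-- The completion of `T` with respect to a C⋆-seminorm is a C⋆-algebra. -/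
instance : NonUnitalCStarAlgebra p.Alg where
  __ := (inferInstance : NormedAddCommGroup p.Alg)
  __ := (inferInstance : NonUnitalRing p.Alg)
  __ := (inferInstance : StarRing p.Alg)
  __ := (inferInstance : NormedSpace ℂ p.Alg)
  __ := (inferInstance : CompleteSpace p.Alg)
  norm_mul_le := p.alg_norm_mul_le
  norm_mul_self_le := p.alg_norm_mul_self_le
  smul_assoc := p.alg_smul_mul
  smul_comm c a b := (p.alg_mul_smul c a b).symm
  star_smul := p.alg_star_smul

end CStarSeminorm

/-! ### C⋆-seminorms on the algebraic tensor product -/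

section TensorAlgebraStar

variable {A : Type u} {C : Type v} [NonUnitalCStarAlgebra A] [NonUnitalCStarAlgebra C]

/-- The algebraic tensor product of C⋆-algebras is a ⋆-algebra, with
`(a ⊗ c)⋆ = a⋆ ⊗ c⋆` and `(a ⊗ c) (a' ⊗ c') = a a' ⊗ c c'`. -/
instance instStarRingAlgTensor : StarRing (A ⊗[ℂ] C) where
  __ := (inferInstance : StarAddMonoid (A ⊗[ℂ] C))
  star_mul x y := by
    induction x using TensorProduct.induction_on with
    | zero => simp
    | add x x' hx hx' => simp only [add_mul, mul_add, star_add, hx, hx']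
    | tmul a c =>
      induction y using TensorProduct.induction_on with
      | zero => simp
      | add y y' hy hy' => simp only [add_mul, mul_add, star_add, hy, hy']
      | tmul a' c' => simp

end TensorAlgebraStar

namespace CStarSeminorm

variable {A : Type u} {C : Type v} [NonUnitalCStarAlgebra A] [NonUnitalCStarAlgebra C]

theorem le_of_smul_eq {T : Type u} [NonUnitalRing T] [StarRing T] [Module ℂ T]
    [IsScalarTower ℂ T T] [SMulCommClass ℂ T T] [StarModule ℂ T] (p : CStarSeminorm T)
    {r : ℝ} (hr : 0 ≤ r) {x y z : T}
    (h : ((r * r : ℝ) : ℂ) • (star y * y) = star x * x + star z * z) : p x ≤ r * p y := by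
  let _ := CStarAlgebra.spectralOrder p.Alg
  have _ := CStarAlgebra.spectralOrderedRing p.Alg
  have h5 : p.toAlg (star x * x) ≤ p.toAlg (((r * r : ℝ) : ℂ) • (star y * y)) := by
    rw [h, toAlg_add, toAlg_mul p (star z), toAlg_star]
    exact le_add_of_nonneg_right (star_mul_self_nonneg (p.toAlg z))
  have h6 : 0 ≤ p.toAlg (star x * x) := by
    rw [toAlg_mul, toAlg_star]
    exact star_mul_self_nonneg (p.toAlg x)
  have h7 := CStarAlgebra.norm_le_norm_of_nonneg_of_le h6 h5
  rw [norm_toAlg, norm_toAlg, p.star_mul_self] at h7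
  have h8 := map_smul_eq_mul p.toSeminorm ((r * r : ℝ) : ℂ) (star y * y)
  change p _ = _ * p _ at h8
  rw [h8, p.star_mul_self, Complex.norm_real, Real.norm_of_nonneg (by positivity)] at h7
  refine abs_le_of_sq_le_sq' ?_ (mul_nonneg hr (p.nonneg _)) |>.2
  rw [mul_pow, pow_two r]
  exact h7

theorem exists_conjugate (a d : A) : ∃ e : A,
    ((‖a‖ * ‖a‖ : ℝ) : ℂ) • (star d * d) = star (a * d) * (a * d) + star e * e := by
  let _ := CStarAlgebra.spectralOrder A
  have _ := CStarAlgebra.spectralOrderedRing A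
  have h1 : star d * (star a * a) * d ≤ ‖star a * a‖ • (star d * d) :=
    CStarAlgebra.star_left_conjugate_le_norm_smul (IsSelfAdjoint.star_mul_self a)
  obtain ⟨e, he⟩ := CStarAlgebra.nonneg_iff_eq_star_mul_self.1 (sub_nonneg.2 h1)
  refine ⟨e, ?_⟩
  rw [← he, CStarRing.norm_star_mul_self, Complex.coe_smul, star_mul]
  simp only [mul_assoc]
  rw [add_sub_cancel]

theorem mul_tmul_le (p : CStarSeminorm (A ⊗[ℂ] C)) (a d : A) (c : C) :
    p ((a * d) ⊗ₜ[ℂ] c) ≤ ‖a‖ * p (d ⊗ₜ[ℂ] c) := by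
  obtain ⟨e, he⟩ := exists_conjugate a d
  refine p.le_of_smul_eq (norm_nonneg a) (z := e ⊗ₜ[ℂ] c) ?_
  simp only [TensorProduct.star_tmul, Algebra.TensorProduct.tmul_mul_tmul,
    ← TensorProduct.add_tmul, ← he, TensorProduct.smul_tmul']

theorem tmul_mul_le (p : CStarSeminorm (A ⊗[ℂ] C)) (a : A) (c d : C) :
    p (a ⊗ₜ[ℂ] (c * d)) ≤ ‖c‖ * p (a ⊗ₜ[ℂ] d) := by
  obtain ⟨e, he⟩ := exists_conjugate c d
  refine p.le_of_smul_eq (norm_nonneg c) (z := a ⊗ₜ[ℂ] e) ?_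
  simp only [TensorProduct.star_tmul, Algebra.TensorProduct.tmul_mul_tmul,
    ← TensorProduct.tmul_add, ← he, TensorProduct.tmul_smul]

/-- Every C⋆-seminorm on the algebraic tensor product is a subcross seminorm. -/
theorem tmul_le (p : CStarSeminorm (A ⊗[ℂ] C)) (a : A) (c : C) :
    p (a ⊗ₜ[ℂ] c) ≤ ‖a‖ * ‖c‖ := by
  have h1 := p.star_mul_self (star (a ⊗ₜ[ℂ] c))
  rw [p.map_star, star_star, TensorProduct.star_tmul, Algebra.TensorProduct.tmul_mul_tmul] at h1
  have h2 := p.mul_tmul_le a (star a) (c * star c)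
  have h3 := p.tmul_mul_le (star a) c (star c)
  rw [← TensorProduct.star_tmul, p.map_star] at h3
  have h4 := p.nonneg (a ⊗ₜ[ℂ] c)
  have h5 := mul_le_mul_of_nonneg_left h3 (norm_nonneg a)
  rcases h4.eq_or_lt with h | h
  · rw [← h]; positivity
  · refine le_of_mul_le_mul_right ?_ h
    rw [← pow_two, ← h1]
    linarith [h2, h5]

theorem exists_bound (x : A ⊗[ℂ] C) : ∃ M : ℝ, ∀ p : CStarSeminorm (A ⊗[ℂ] C), p x ≤ M := by
  induction x using TensorProduct.induction_on with
  | zero => exact ⟨0, fun p => (map_zero p.toSeminorm).le⟩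
  | tmul a c => exact ⟨‖a‖ * ‖c‖, fun p => p.tmul_le a c⟩
  | add x y hx hy =>
    obtain ⟨M, hM⟩ := hx
    obtain ⟨N, hN⟩ := hy
    exact ⟨M + N, fun p => (p.add_le x y).trans (add_le_add (hM p) (hN p))⟩

theorem bddAbove_range (S : Set (CStarSeminorm (A ⊗[ℂ] C))) (x : A ⊗[ℂ] C) :
    BddAbove (Set.range fun p : S => p.1 x) := by
  obtain ⟨M, hM⟩ := exists_bound x
  exact ⟨M, by rintro _ ⟨p, rfl⟩; exact hM p.1⟩

/-- The pointwise supremum of a set of C⋆-seminorms on the algebraic tensor product.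
It is a genuine (finite) supremum by `bddAbove_range`. -/
def supSeminorm (S : Set (CStarSeminorm (A ⊗[ℂ] C))) : CStarSeminorm (A ⊗[ℂ] C) where
  toFun x := ⨆ p : S, p.1 x
  map_zero' := by
    have h : ∀ p : S, p.1 0 = 0 := fun p => map_zero p.1.toSeminorm
    simp only [h, Real.iSup_const_zero]
  add_le' x y := Real.iSup_le
    (fun p => (p.1.add_le x y).trans
      (add_le_add (le_ciSup (bddAbove_range S x) p) (le_ciSup (bddAbove_range S y) p)))
    (add_nonneg (Real.iSup_nonneg fun p => p.1.nonneg x) (Real.iSup_nonneg fun p => p.1.nonneg y))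
  neg' x := by
    have h : ∀ p : S, p.1 (-x) = p.1 x := fun p => map_neg_eq_map p.1.toSeminorm x
    simp only [h]
  smul' c x := by
    have h : ∀ p : S, p.1 (c • x) = ‖c‖ * p.1 x := fun p => map_smul_eq_mul p.1.toSeminorm c x
    simp only [h, Real.mul_iSup_of_nonneg (norm_nonneg c)]
  mul_le x y := Real.iSup_le
    (fun p => (p.1.mul_le x y).trans
      (mul_le_mul (le_ciSup (bddAbove_range S x) p) (le_ciSup (bddAbove_range S y) p)
        (p.1.nonneg y) (Real.iSup_nonneg fun p => p.1.nonneg x)))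
    (mul_nonneg (Real.iSup_nonneg fun p => p.1.nonneg x) (Real.iSup_nonneg fun p => p.1.nonneg y))
  star_mul_self x := by
    apply le_antisymm
    · refine Real.iSup_le (fun p => ?_) (sq_nonneg _)
      rw [p.1.star_mul_self]
      exact pow_le_pow_left₀ (p.1.nonneg x) (le_ciSup (bddAbove_range S x) p) 2
    · have h0 : 0 ≤ ⨆ p : S, p.1 (star x * x) := Real.iSup_nonneg fun p => p.1.nonneg _
      have h1 : ⨆ p : S, p.1 x ≤ √(⨆ p : S, p.1 (star x * x)) := by
        refine Real.iSup_le (fun p => Real.le_sqrt_of_sq_le ?_) (Real.sqrt_nonneg _)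
        rw [← p.1.star_mul_self]
        exact le_ciSup (bddAbove_range S (star x * x)) p
      calc (⨆ p : S, p.1 x) ^ 2 ≤ √(⨆ p : S, p.1 (star x * x)) ^ 2 :=
            pow_le_pow_left₀ (Real.iSup_nonneg fun p => p.1.nonneg x) h1 2
        _ = _ := Real.sq_sqrt h0

end CStarSeminorm

/-! ### Spatial C⋆-seminorms -/

section Spatial

variable {H : Type u} [NormedAddCommGroup H] [InnerProductSpace ℂ H]
  {K : Type v} [NormedAddCommGroup K] [InnerProductSpace ℂ K]

variable (H K) in
/-- The Hilbert space tensor product of `H` and `K`: the completion of the algebraic tensor product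
with respect to the inner product `⟪ξ ⊗ η, ξ' ⊗ η'⟫ = ⟪ξ, ξ'⟫ ⟪η, η'⟫`. -/
def HilbertTensor : Type (max u v) := UniformSpace.Completion (H ⊗[ℂ] K)

instance : NormedAddCommGroup (HilbertTensor H K) :=
  inferInstanceAs (NormedAddCommGroup (UniformSpace.Completion (H ⊗[ℂ] K)))
instance : InnerProductSpace ℂ (HilbertTensor H K) :=
  inferInstanceAs (InnerProductSpace ℂ (UniformSpace.Completion (H ⊗[ℂ] K)))
instance : CompleteSpace (HilbertTensor H K) :=
  inferInstanceAs (CompleteSpace (UniformSpace.Completion (H ⊗[ℂ] K)))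

/-- The canonical linear embedding of the algebraic tensor product. -/
def toHilbertTensor : (H ⊗[ℂ] K) →ₗ[ℂ] HilbertTensor H K :=
  (UniformSpace.Completion.toComplₗᵢ (𝕜 := ℂ) (E := H ⊗[ℂ] K)).toLinearMap

theorem hilbertTensor_induction {P : HilbertTensor H K → Prop} (x : HilbertTensor H K)
    (hP : IsClosed {x | P x}) (h : ∀ x : H ⊗[ℂ] K, P (toHilbertTensor x)) : P x :=
  UniformSpace.Completion.induction_on x hP h

/-- The elementary tensor `ξ ⊗ η` in the Hilbert space tensor product. -/
def hilbertTmul (ξ : H) (η : K) : HilbertTensor H K := toHilbertTensor (ξ ⊗ₜ[ℂ] η)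

theorem inner_hilbertTmul (ξ ξ' : H) (η η' : K) :
    inner ℂ (hilbertTmul ξ η) (hilbertTmul ξ' η') = inner ℂ ξ ξ' * inner ℂ η η' :=
  (UniformSpace.Completion.inner_coe (𝕜 := ℂ) (ξ ⊗ₜ[ℂ] η) (ξ' ⊗ₜ[ℂ] η')).trans
    (TensorProduct.inner_tmul ℂ ξ ξ' η η')

theorem hilbertTensor_ext {S T : HilbertTensor H K →L[ℂ] HilbertTensor H K}
    (h : ∀ ξ η, S (hilbertTmul ξ η) = T (hilbertTmul ξ η)) : S = T := by
  ext x
  refine hilbertTensor_induction x (isClosed_eq S.continuous T.continuous) fun x => ?_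
  induction x using TensorProduct.induction_on with
  | zero => simp only [map_zero]
  | tmul ξ η => exact h ξ η
  | add x y hx hy => simp only [map_add, hx, hy]

/-- The bounded operator `S ⊗ T` on the Hilbert space tensor product. -/
def opTensor (S : H →L[ℂ] H) (T : K →L[ℂ] K) : HilbertTensor H K →L[ℂ] HilbertTensor H K :=
  (TensorProduct.mapL S T).completion

theorem opTensor_hilbertTmul (S : H →L[ℂ] H) (T : K →L[ℂ] K) (ξ : H) (η : K) :
    opTensor S T (hilbertTmul ξ η) = hilbertTmul (S ξ) (T η) :=
  ContinuousLinearMap.completion_apply_coe (TensorProduct.mapL S T) (ξ ⊗ₜ[ℂ] η)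

theorem hilbertTmul_add_left (ξ ξ' : H) (η : K) :
    hilbertTmul (ξ + ξ') η = hilbertTmul ξ η + hilbertTmul ξ' η := by
  simp only [hilbertTmul, TensorProduct.add_tmul, map_add]

theorem hilbertTmul_add_right (ξ : H) (η η' : K) :
    hilbertTmul ξ (η + η') = hilbertTmul ξ η + hilbertTmul ξ η' := by
  simp only [hilbertTmul, TensorProduct.tmul_add, map_add]

theorem hilbertTmul_smul_left (r : ℂ) (ξ : H) (η : K) :
    hilbertTmul (r • ξ) η = r • hilbertTmul ξ η := by
  simp only [hilbertTmul, ← TensorProduct.smul_tmul', map_smul]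

theorem hilbertTmul_smul_right (r : ℂ) (ξ : H) (η : K) :
    hilbertTmul ξ (r • η) = r • hilbertTmul ξ η := by
  simp only [hilbertTmul, TensorProduct.tmul_smul, map_smul]

theorem opTensor_mul (S S' : H →L[ℂ] H) (T T' : K →L[ℂ] K) :
    opTensor (S * S') (T * T') = opTensor S T * opTensor S' T' :=
  hilbertTensor_ext fun ξ η => by
    simp only [mul_apply_eq_comp, opTensor_hilbertTmul]

theorem star_opTensor [CompleteSpace H] [CompleteSpace K] (S : H →L[ℂ] H) (T : K →L[ℂ] K) :
    opTensor (star S) (star T) = star (opTensor S T) := by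
  refine (ContinuousLinearMap.eq_adjoint_iff _ _).2 fun x y => ?_
  refine hilbertTensor_induction x (isClosed_eq
    ((opTensor (star S) (star T)).continuous.inner continuous_const)
    (continuous_id.inner continuous_const)) fun x => ?_
  refine hilbertTensor_induction y (isClosed_eq
    (continuous_const.inner continuous_id)
    (continuous_const.inner (opTensor S T).continuous)) fun y => ?_
  induction x using TensorProduct.induction_on with
  | zero => simp only [map_zero, inner_zero_left, id_eq]
  | add x x' hx hx' => simp only [map_add, inner_add_left, id_eq] at *; rw [hx, hx']
  | tmul ξ η =>
    induction y using TensorProduct.induction_on with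
    | zero => simp only [map_zero, inner_zero_right, id_eq]
    | add y y' hy hy' => simp only [map_add, inner_add_right, id_eq] at *; rw [hy, hy']
    | tmul ξ' η' =>
      change inner ℂ (opTensor _ _ (hilbertTmul ξ η)) (hilbertTmul ξ' η') =
        inner ℂ (hilbertTmul ξ η) (opTensor _ _ (hilbertTmul ξ' η'))
      rw [opTensor_hilbertTmul, opTensor_hilbertTmul, inner_hilbertTmul, inner_hilbertTmul,
        ContinuousLinearMap.star_eq_adjoint, ContinuousLinearMap.star_eq_adjoint,
        ContinuousLinearMap.adjoint_inner_left, ContinuousLinearMap.adjoint_inner_left]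

variable {A : Type u} {C : Type v} [NonUnitalCStarAlgebra A] [NonUnitalCStarAlgebra C]
  [CompleteSpace H] [CompleteSpace K]

/-- The linear map `a ⊗ c ↦ π(a) ⊗ ρ(c)` for representations `π` of `A` on `H` and `ρ` of `C`
on `K`. -/
def tensorRepLinear (π : A →⋆ₙₐ[ℂ] (H →L[ℂ] H)) (ρ : C →⋆ₙₐ[ℂ] (K →L[ℂ] K)) :
    (A ⊗[ℂ] C) →ₗ[ℂ] (HilbertTensor H K →L[ℂ] HilbertTensor H K) :=
  TensorProduct.lift (LinearMap.mk₂ ℂ (fun a c => opTensor (π a) (ρ c))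
    (fun a a' c => hilbertTensor_ext fun ξ η => by
      simp only [map_add, add_apply, opTensor_hilbertTmul, hilbertTmul_add_left])
    (fun r a c => hilbertTensor_ext fun ξ η => by
      simp only [map_smul, smul_apply, opTensor_hilbertTmul, hilbertTmul_smul_left])
    (fun a c c' => hilbertTensor_ext fun ξ η => by
      simp only [map_add, add_apply, opTensor_hilbertTmul, hilbertTmul_add_right])
    (fun r a c => hilbertTensor_ext fun ξ η => by
      simp only [map_smul, smul_apply, opTensor_hilbertTmul, hilbertTmul_smul_right]))

/-- The tensor product representation `π ⊗ ρ` of the algebraic tensor product on the Hilbert space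
tensor product: `(π ⊗ ρ)(a ⊗ c) = π(a) ⊗ ρ(c)`. -/
def tensorRep (π : A →⋆ₙₐ[ℂ] (H →L[ℂ] H)) (ρ : C →⋆ₙₐ[ℂ] (K →L[ℂ] K)) :
    (A ⊗[ℂ] C) →⋆ₙₐ[ℂ] (HilbertTensor H K →L[ℂ] HilbertTensor H K) where
  toFun x := tensorRepLinear π ρ x
  map_smul' c x := map_smul _ c x
  map_zero' := map_zero _
  map_add' x y := map_add _ x y
  map_mul' x y := by
    induction x using TensorProduct.induction_on with
    | zero => simp only [zero_mul, map_zero]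
    | add x x' hx hx' => simp only [add_mul, map_add, hx, hx']
    | tmul a c =>
      induction y using TensorProduct.induction_on with
      | zero => simp only [mul_zero, map_zero]
      | add y y' hy hy' => simp only [mul_add, map_add, hy, hy']
      | tmul a' c' =>
        simp only [tensorRepLinear, Algebra.TensorProduct.tmul_mul_tmul, TensorProduct.lift.tmul,
          LinearMap.mk₂_apply, map_mul, opTensor_mul]
  map_star' x := by
    induction x using TensorProduct.induction_on with
    | zero => simp only [star_zero, map_zero]
    | add x x' hx hx' => simp only [star_add, map_add, hx, hx']
    | tmul a c =>
      simp only [tensorRepLinear, TensorProduct.star_tmul, TensorProduct.lift.tmul,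
        LinearMap.mk₂_apply, map_star, star_opTensor]

theorem tensorRep_tmul (π : A →⋆ₙₐ[ℂ] (H →L[ℂ] H)) (ρ : C →⋆ₙₐ[ℂ] (K →L[ℂ] K)) (a : A) (c : C) :
    tensorRep π ρ (a ⊗ₜ[ℂ] c) = opTensor (π a) (ρ c) := by
  change tensorRepLinear π ρ (a ⊗ₜ[ℂ] c) = _
  simp only [tensorRepLinear, TensorProduct.lift.tmul, LinearMap.mk₂_apply]

/-- The C⋆-seminorm `x ↦ ‖(π ⊗ ρ)(x)‖` on the algebraic tensor product of `A` and `C`. -/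
def spatialSeminorm (π : A →⋆ₙₐ[ℂ] (H →L[ℂ] H)) (ρ : C →⋆ₙₐ[ℂ] (K →L[ℂ] K)) :
    CStarSeminorm (A ⊗[ℂ] C) where
  toFun x := ‖tensorRep π ρ x‖
  map_zero' := by rw [map_zero, norm_zero]
  add_le' x y := by rw [map_add]; exact norm_add_le _ _
  neg' x := by rw [map_neg, norm_neg]
  smul' c x := by rw [map_smul, norm_smul]
  mul_le x y := by rw [map_mul]; exact norm_mul_le _ _
  star_mul_self x := by rw [map_mul, map_star, CStarRing.norm_star_mul_self, pow_two]

end Spatial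

/-! ### The minimal and the maximal tensor product -/

section TensorProducts

variable (A : Type u) (C : Type v) [NonUnitalCStarAlgebra A] [NonUnitalCStarAlgebra C]

/-- The minimal (spatial) C⋆-norm on the algebraic tensor product: the supremum of
`‖(π ⊗ ρ)(x)‖` over all representations `π` of `A` and `ρ` of `C` on Hilbert spaces. -/
def minSeminorm : CStarSeminorm (A ⊗[ℂ] C) :=
  CStarSeminorm.supSeminorm
    {p | ∃ (H : Type u) (_ : NormedAddCommGroup H) (_ : InnerProductSpace ℂ H)
      (_ : CompleteSpace H) (K : Type v) (_ : NormedAddCommGroup K) (_ : InnerProductSpace ℂ K)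
      (_ : CompleteSpace K) (π : A →⋆ₙₐ[ℂ] (H →L[ℂ] H)) (ρ : C →⋆ₙₐ[ℂ] (K →L[ℂ] K)),
      p = spatialSeminorm π ρ}

/-- The maximal C⋆-norm on the algebraic tensor product: the supremum of all C⋆-seminorms. -/
def maxSeminorm : CStarSeminorm (A ⊗[ℂ] C) :=
  CStarSeminorm.supSeminorm Set.univ

/-- The minimal tensor product of the C⋆-algebras `A` and `C`: the completion of the algebraic
tensor product in the minimal C⋆-norm. -/
def MinTensor : Type (max u v) := (minSeminorm A C).Alg

/-- The maximal tensor product of the C⋆-algebras `A` and `C`: the completion of the algebraic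
tensor product in the maximal C⋆-norm. -/
def MaxTensor : Type (max u v) := (maxSeminorm A C).Alg

instance : NonUnitalCStarAlgebra (MinTensor A C) :=
  inferInstanceAs (NonUnitalCStarAlgebra (minSeminorm A C).Alg)

instance : NonUnitalCStarAlgebra (MaxTensor A C) :=
  inferInstanceAs (NonUnitalCStarAlgebra (maxSeminorm A C).Alg)

variable {A C}

/-- The elementary tensor `a ⊗ c` in the minimal tensor product. -/
def minTmul (a : A) (c : C) : MinTensor A C := (minSeminorm A C).toAlg (a ⊗ₜ[ℂ] c)

/-- The elementary tensor `a ⊗ c` in the maximal tensor product. -/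
def maxTmul (a : A) (c : C) : MaxTensor A C := (maxSeminorm A C).toAlg (a ⊗ₜ[ℂ] c)

end TensorProducts

section TensorMaps

variable {A B C D : Type u} [NonUnitalCStarAlgebra A] [NonUnitalCStarAlgebra B]
  [NonUnitalCStarAlgebra C] [NonUnitalCStarAlgebra D]

/-- The bounded linear map `α` is the tensor product map `φ ⊗ ψ` between minimal tensor products:
`α (a ⊗ c) = φ(a) ⊗ ψ(c)`. As elementary tensors span a dense subspace, there is at most one
such `α`. -/
def IsMinTensorMap (φ : A →L[ℂ] B) (ψ : C →L[ℂ] D) (α : MinTensor A C →L[ℂ] MinTensor B D) :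
    Prop :=
  ∀ (a : A) (c : C), α (minTmul a c) = minTmul (φ a) (ψ c)

/-- The bounded linear map `α` is the tensor product map `φ ⊗ ψ` between maximal tensor products:
`α (a ⊗ c) = φ(a) ⊗ ψ(c)`. As elementary tensors span a dense subspace, there is at most one
such `α`. -/
def IsMaxTensorMap (φ : A →L[ℂ] B) (ψ : C →L[ℂ] D) (α : MaxTensor A C →L[ℂ] MaxTensor B D) :
    Prop :=
  ∀ (a : A) (c : C), α (maxTmul a c) = maxTmul (φ a) (ψ c)

end TensorMaps

end

/-! Zero products are not visible on elementary tensors: `x * y = 0` in a completed tensor product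
says nothing about the tensors that approximate `x` and `y`. The way out is to replace each
preserver condition by an equivalent multilinear identity.

The source of the identities is that C⋆-algebras are zero-product balanced
(`apply_mul_eq_apply_mul`): a bounded bilinear map that vanishes on pairs with zero product
satisfies `B (a * b) c = B a (b * c)`. Hence φ preserves zero-products iff `φ (a * b) * φ c = φ a *
φ (b * c)`, and range-orthogonality iff `star (φ (c * a)) * φ b = star (φ a) * φ (star c * b)`; the
converses use approximate units. Domain-orthogonality is range-orthogonality of `a ↦ star (φ (star
a))`, and preserving zero-TRO-products amounts to preserving both orthogonalities. Such identities
are additive and continuous in each variable, so they pass from elementary tensors to the completed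
tensor product, which settles preservation.

Existence needs a norm bound, and only for range-orthogonality. Write Φ for the algebraic tensor
map. The identity makes left multiplication `Φ x ↦ Φ (y * x)` behave like a ⋆-representation of the
algebraic tensor product on the range of Φ.

For the maximal norm, the operator norm of this multiplication is itself a C⋆-seminorm, hence is
dominated by the maximal one. For the minimal norm, each representation π of `B` yields a
representation π' of `A` on the same Hilbert space with `π' a * π (φ b) = π (φ (a * b))`, and
likewise for ψ; so `(π ⊗ ρ) (Φ (y * a ⊗ c))` factors as `(π' ⊗ ρ') y` times a bounded operator. In
both cases letting `a` and `c` run through approximate units gives the bound `‖φ‖ * ‖ψ‖`.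
Boundedness of the multiplications comes from an iterated Cauchy–Schwarz argument
(`le_mul_of_sq_le_mul_succ`). -/

noncomputable section

/-! ### Zero-product balancedness of C⋆-algebras -/

/-- The clamp of `t - i` to the unit interval. -/
def clampAt (i : ℕ) (t : ℝ) : ℝ := min 1 (max 0 (t - i))

theorem continuous_clampAt (i : ℕ) : Continuous (clampAt i) := by
  unfold clampAt; fun_prop

theorem clampAt_nonneg (i : ℕ) (t : ℝ) : 0 ≤ clampAt i t := by
  unfold clampAt; positivity

theorem clampAt_le_one (i : ℕ) (t : ℝ) : clampAt i t ≤ 1 := min_le_left _ _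

theorem clampAt_of_le {i : ℕ} {t : ℝ} (h : t ≤ i) : clampAt i t = 0 := by
  unfold clampAt
  rw [max_eq_left (by linarith)]
  norm_num

theorem clampAt_of_ge {i : ℕ} {t : ℝ} (h : (i : ℝ) + 1 ≤ t) : clampAt i t = 1 := by
  unfold clampAt
  rw [max_eq_right (by linarith), min_eq_left (by linarith)]

theorem clampAt_succ_le (i : ℕ) (t : ℝ) : clampAt (i + 1) t ≤ clampAt i t := by
  unfold clampAt
  push_cast
  gcongr
  linarith

theorem sum_clampAt {N : ℕ} {t : ℝ} (h0 : 0 ≤ t) (h : t ≤ N) :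
    ∑ i ∈ Finset.range N, clampAt i t = t := by
  induction N generalizing t with
  | zero => push_cast at h; simp; linarith
  | succ N ih =>
    rw [Finset.sum_range_succ]
    rcases le_total t N with h1 | h1
    · rw [ih h0 h1, clampAt_of_le h1, add_zero]
    · have h2 : ∀ i ∈ Finset.range N, clampAt i t = 1 := by
        intro i hi
        have : (i : ℝ) + 1 ≤ N := by exact_mod_cast Finset.mem_range.1 hi
        exact clampAt_of_ge (by linarith)
      rw [Finset.sum_congr rfl h2]
      push_cast at h
      unfold clampAt
      rw [max_eq_right (by linarith), min_eq_right (by linarith)]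
      simp

theorem clampAt_succ_mul (i : ℕ) (t : ℝ) : clampAt (i + 1) t * (1 - clampAt i t) = 0 := by
  rcases le_total t ((i + 1 : ℕ) : ℝ) with h | h
  · rw [clampAt_of_le h, zero_mul]
  · rw [clampAt_of_ge (i := i) (by exact_mod_cast h), sub_self, mul_zero]

theorem clampAt_add_mul {i j : ℕ} (hij : i + 2 ≤ j) (t : ℝ) :
    clampAt j t * (clampAt i t - clampAt (i + 1) t) = 0 := by
  have hij' : (i : ℝ) + 2 ≤ j := by exact_mod_cast hij
  rcases le_total t j with h | h
  · rw [clampAt_of_le h, zero_mul]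
  · rw [clampAt_of_ge (i := i) (by linarith), clampAt_of_ge (i := i + 1) (by push_cast; linarith),
      sub_self, mul_zero]

/-- The differences are nonnegative, and over an initial segment they telescope to `clampAt 0 t -
clampAt M t`. The bound is thus independent of `s`, which keeps all later estimates uniform. -/
theorem abs_sum_clampAt_sub_le (s : Finset ℕ) (t : ℝ) :
    |∑ i ∈ s, (clampAt i t - clampAt (i + 1) t)| ≤ 1 := by
  have h0 : ∀ i, 0 ≤ clampAt i t - clampAt (i + 1) t := fun i => sub_nonneg.2 (clampAt_succ_le i t)
  rw [abs_of_nonneg (Finset.sum_nonneg fun i _ => h0 i)]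
  obtain ⟨M, hM⟩ := s.exists_nat_subset_range
  refine (Finset.sum_le_sum_of_subset_of_nonneg hM fun i _ _ => h0 i).trans ?_
  rw [Finset.sum_range_sub']
  linarith [clampAt_le_one 0 t, clampAt_nonneg M t]

section Balanced

variable {U X : Type*} [CStarAlgebra U] [NormedAddCommGroup X] [NormedSpace ℂ X]

/-- The bound must not grow with `N`. Inside one residue class modulo 3, distinct `i` and `j` differ
by at least 3, so `i + 1` and `j` differ by at least 2 and the cross terms vanish. The diagonal sum
is then `B` evaluated at two vectors of norm at most 1. Two such terms in each of three classes
account for the constant 6. -/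
theorem norm_sum_sub_apply_le (B : U →L[ℂ] U →L[ℂ] X) (w : ℕ → U)
    (h1 : ∀ i j, i + 2 ≤ j → B (w j) (w i) = 0) (h2 : ∀ i j, i + 2 ≤ j → B (w i) (w j) = 0)
    (hw : ∀ s : Finset ℕ, ‖∑ i ∈ s, w i‖ ≤ 1) (N : ℕ) :
    ‖∑ i ∈ Finset.range N, (B (w (i + 1)) (w i) - B (w i) (w (i + 1)))‖ ≤ 6 * ‖B‖ := by
  have hw' : ∀ s : Finset ℕ, ‖∑ i ∈ s, w (i + 1)‖ ≤ 1 := fun s => by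
    simpa using hw (s.map (addRightEmbedding 1))
  have hB : ∀ x y : U, ‖x‖ ≤ 1 → ‖y‖ ≤ 1 → ‖B x y‖ ≤ ‖B‖ := fun x y hx hy =>
    (B.le_opNorm₂ x y).trans (by
      calc ‖B‖ * ‖x‖ * ‖y‖ ≤ ‖B‖ * 1 * 1 := by gcongr
        _ = ‖B‖ := by ring)
  have key : ∀ r : ℕ, ‖∑ i ∈ Finset.range N with i % 3 = r,
      (B (w (i + 1)) (w i) - B (w i) (w (i + 1)))‖ ≤ 2 * ‖B‖ := by
    intro r
    set s := (Finset.range N).filter (fun i => i % 3 = r) with hs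
    have hmod : ∀ i ∈ s, ∀ j ∈ s, i ≠ j → i + 3 ≤ j ∨ j + 3 ≤ i := by
      intro i hi j hj hij
      have := (Finset.mem_filter.1 hi).2
      have := (Finset.mem_filter.1 hj).2
      omega
    have e1 : ∑ i ∈ s, B (w (i + 1)) (w i) = B (∑ i ∈ s, w (i + 1)) (∑ j ∈ s, w j) := by
      simp only [map_sum, sum_apply]
      rw [Finset.sum_comm]
      refine Finset.sum_congr rfl fun i hi => ?_
      rw [Finset.sum_eq_single_of_mem i hi]
      intro j hj hij
      rcases hmod i hi j hj hij.symm with h | h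
      · exact h2 _ _ (by omega)
      · exact h1 _ _ (by omega)
    have e2 : ∑ i ∈ s, B (w i) (w (i + 1)) = B (∑ i ∈ s, w i) (∑ j ∈ s, w (j + 1)) := by
      simp only [map_sum, sum_apply]
      rw [Finset.sum_comm]
      refine Finset.sum_congr rfl fun i hi => ?_
      rw [Finset.sum_eq_single_of_mem i hi]
      intro j hj hij
      rcases hmod i hi j hj hij.symm with h | h
      · exact h2 _ _ (by omega)
      · exact h1 _ _ (by omega)
    rw [Finset.sum_sub_distrib, e1, e2, two_mul]
    exact (norm_sub_le _ _).trans (add_le_add (hB _ _ (hw' s) (hw s)) (hB _ _ (hw s) (hw' s)))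
  rw [← Finset.sum_fiberwise_of_maps_to (t := Finset.range 3) (g := fun i => i % 3)
    (fun i _ => Finset.mem_range.2 (Nat.mod_lt i (by norm_num)))]
  refine (norm_sum_le _ _).trans ((Finset.sum_le_sum fun r _ => key r).trans ?_)
  simp only [Finset.sum_const, Finset.card_range, nsmul_eq_mul]
  push_cast
  linarith

/-- The clamps cut `b` into unit slices `u i`, and slices far apart are orthogonal in the sense
needed for `B` to vanish. Only interactions of neighbouring slices survive in the commutator-like
difference, and those are bounded uniformly in the length of the spectrum. -/
theorem norm_apply_one_sub_le (B : U →L[ℂ] U →L[ℂ] X)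
    (hB : ∀ x y, x * y = 0 → B x y = 0) {b : U} (hb : IsSelfAdjoint b) (N : ℕ)
    (hN : ∀ t ∈ spectrum ℝ b, 1 ≤ t ∧ t ≤ N + 1) :
    ‖B b 1 - B 1 b‖ ≤ 6 * ‖B‖ := by
  set u : ℕ → U := fun i => cfc (clampAt i) b with hu
  have hc := continuous_clampAt
  have hwc : ∀ i, u i - u (i + 1) = cfc (fun t => clampAt i t - clampAt (i + 1) t) b := fun i =>
    (cfc_sub (clampAt i) (clampAt (i + 1)) b (hc i).continuousOn (hc (i + 1)).continuousOn).symm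
  have hwcont : ∀ i, Continuous fun t => clampAt i t - clampAt (i + 1) t :=
    fun i => (hc i).sub (hc (i + 1))
  have hu0 : u 0 = 1 := by
    rw [hu, ← cfc_one ℝ b]
    exact cfc_congr fun t ht => clampAt_of_ge (by simpa using (hN t ht).1)
  have hbsum : b = 1 + ∑ i ∈ Finset.range N, u (i + 1) := by
    have h1 : b = ∑ i ∈ Finset.range (N + 1), u i := by
      rw [hu, ← cfc_sum _ b _ fun i _ => (hc i).continuousOn]
      conv_lhs => rw [← cfc_id ℝ b]
      refine cfc_congr fun t ht => ?_
      rw [Finset.sum_apply]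
      change t = _
      exact (sum_clampAt (by linarith [(hN t ht).1]) (by exact_mod_cast (hN t ht).2)).symm
    rw [h1, Finset.sum_range_succ', hu0, add_comm]
  have mul_zero_of : ∀ f g : ℝ → ℝ, Continuous f → Continuous g → (∀ t, f t * g t = 0) →
      cfc f b * cfc g b = 0 := by
    intro f g hf hg h
    rw [← cfc_mul f g b hf.continuousOn hg.continuousOn]
    simp only [h]
    exact cfc_const_zero ℝ b
  have h1sub : ∀ i, 1 - u i = cfc (fun t => 1 - clampAt i t) b := fun i => by
    rw [cfc_sub (fun _ => (1 : ℝ)) (clampAt i) b continuousOn_const (hc i).continuousOn,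
      cfc_const_one ℝ b]
  have ha : ∀ i, B (u (i + 1)) (1 - u i) = 0 ∧ B (1 - u i) (u (i + 1)) = 0 := fun i => by
    rw [h1sub]
    exact ⟨hB _ _ (mul_zero_of _ _ (hc _) (by fun_prop) (clampAt_succ_mul i)),
      hB _ _ (mul_zero_of _ _ (by fun_prop) (hc _) fun t => by
        rw [mul_comm, clampAt_succ_mul i])⟩
  have hz : ∀ i j, i + 2 ≤ j → B (u j) (u i - u (i + 1)) = 0 ∧ B (u i - u (i + 1)) (u j) = 0 :=
    fun i j hij => by
      rw [hwc]
      exact ⟨hB _ _ (mul_zero_of _ _ (hc _) (hwcont i) (clampAt_add_mul hij)),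
        hB _ _ (mul_zero_of _ _ (hwcont i) (hc _) fun t => by rw [mul_comm, clampAt_add_mul hij])⟩
  -- With `w i = u i - u (i + 1)`: since `u (i + 1) * (1 - u i) = 0`, the unit may be replaced by `u
  -- i`; subtracting `B (u (i + 1)) (u (i + 1))` from both terms turns `u i` into `w i`; and `u (i +
  -- 2) * w i = 0` lets `w (i + 1)` replace `u (i + 1)`.
  have hterm : ∀ i, B (u (i + 1)) 1 - B 1 (u (i + 1)) =
      B (u (i + 1) - u (i + 1 + 1)) (u i - u (i + 1)) -
        B (u i - u (i + 1)) (u (i + 1) - u (i + 1 + 1)) := by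
    intro i
    obtain ⟨a1, a2⟩ := ha i
    obtain ⟨z1, z2⟩ := hz i (i + 1 + 1) le_rfl
    simp only [map_sub, sub_apply] at a1 a2 z1 z2 ⊢
    rw [sub_eq_zero.1 a1, sub_eq_zero.1 a2]
    rw [sub_eq_zero] at z1 z2
    rw [z1, z2]
    abel
  have hdiff : B b 1 - B 1 b = ∑ i ∈ Finset.range N,
      (B (u (i + 1) - u (i + 1 + 1)) (u i - u (i + 1)) -
        B (u i - u (i + 1)) (u (i + 1) - u (i + 1 + 1))) := by
    rw [← Finset.sum_congr rfl fun i _ => hterm i, Finset.sum_sub_distrib]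
    conv_lhs => rw [hbsum]
    simp only [map_add, map_sum, add_apply, sum_apply]
    abel
  rw [hdiff]
  refine norm_sum_sub_apply_le B (fun i => u i - u (i + 1)) ?_ ?_ ?_ N
  · intro i j hij
    rw [map_sub B, sub_apply, (hz i j hij).1, (hz i (j + 1) (by omega)).1,
      sub_zero]
  · intro i j hij
    rw [map_sub, (hz i j hij).2, (hz i (j + 1) (by omega)).2, sub_zero]
  · intro s
    simp only [hwc]
    rw [← cfc_sum _ b s fun i _ => (hwcont i).continuousOn]
    refine norm_cfc_le zero_le_one fun t _ => ?_
    simpa using abs_sum_clampAt_sub_le s t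

/-- The difference `B b 1 - B 1 b` ignores scalar shifts of `b` and is homogeneous in `b`, while the
preceding bound does not see the size of the spectrum. Scaling `b` by `n` therefore bounds it by `6
* ‖B‖ / n`. -/
theorem apply_one_eq_of_isSelfAdjoint (B : U →L[ℂ] U →L[ℂ] X)
    (hB : ∀ x y, x * y = 0 → B x y = 0) {b : U} (hb : IsSelfAdjoint b) : B b 1 = B 1 b := by
  rw [← sub_eq_zero, ← norm_le_zero_iff]
  refine le_of_forall_pos_le_add fun ε hε => ?_
  obtain ⟨n, hn⟩ := exists_nat_gt (6 * ‖B‖ / ε)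
  have hn0 : (0 : ℝ) < n := lt_of_le_of_lt (by positivity) hn
  -- The spectrum of `n • b` lies in `[-M, M]`; the shift by `M + 1` moves it into `[1, 2 * M + 1]`.
  obtain ⟨M, hM⟩ := exists_nat_ge (n * ‖b‖ * ‖(1 : U)‖)
  set b' : U := algebraMap ℝ U (M + 1) + (n : ℝ) • b with hb'
  have hsa : IsSelfAdjoint b' :=
    (IsSelfAdjoint.algebraMap U (IsSelfAdjoint.all _)).add ((IsSelfAdjoint.all _).smul hb)
  have hspec : ∀ t ∈ spectrum ℝ b', 1 ≤ t ∧ t ≤ ((2 * M : ℕ) : ℝ) + 1 := by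
    intro t ht
    have h1 : t - (M + 1) ∈ spectrum ℝ ((n : ℝ) • b) := by
      rw [hb', ← sub_add_cancel t ((M : ℝ) + 1)] at ht
      exact spectrum.add_mem_add_iff.1 ht
    have h2 := spectrum.norm_le_norm_mul_of_mem h1
    rw [norm_smul, Real.norm_natCast] at h2
    have h3 := abs_le.1 ((Real.norm_eq_abs _).symm.le.trans (h2.trans hM))
    push_cast
    constructor <;> linarith [h3.1, h3.2]
  have h := norm_apply_one_sub_le B hB hsa (2 * M) hspec
  have e : B b' 1 - B 1 b' = (n : ℂ) • (B b 1 - B 1 b) := by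
    have : b' = ((M : ℂ) + 1) • (1 : U) + (n : ℂ) • b := by
      rw [hb', Algebra.algebraMap_eq_smul_one, ← Complex.coe_smul, ← Complex.coe_smul]
      push_cast
      rfl
    rw [this]
    simp only [map_add, map_smul, add_apply, smul_apply,
      smul_sub]
    abel
  rw [e, norm_smul, Complex.norm_natCast] at h
  rw [zero_add]
  rw [div_lt_iff₀ hε] at hn
  nlinarith

theorem apply_one_eq (B : U →L[ℂ] U →L[ℂ] X)
    (hB : ∀ x y, x * y = 0 → B x y = 0) (b : U) : B b 1 = B 1 b := by
  rw [← realPart_add_I_smul_imaginaryPart b]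
  simp only [map_add, map_smul, add_apply, smul_apply,
    apply_one_eq_of_isSelfAdjoint B hB (realPart b).2,
    apply_one_eq_of_isSelfAdjoint B hB (imaginaryPart b).2]

end Balanced

/-- C⋆-algebras are zero-product balanced. -/
theorem apply_mul_eq_apply_mul {A X : Type*} [NonUnitalCStarAlgebra A] [NormedAddCommGroup X]
    [NormedSpace ℂ X] (B : A →L[ℂ] A →L[ℂ] X) (hB : ∀ x y, x * y = 0 → B x y = 0) (a b c : A) :
    B (a * b) c = B a (b * c) := by
  -- The unital case is applied to `(x, y) ↦ B (a * x) (y * c)` on the unitization. Both arguments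
  -- lie in the ideal `A`, so `snd` loses nothing, and `x * y = 0` forces `(a * x) * (y * c) = 0`.
  let S : Unitization ℂ A →L[ℂ] A := ⟨Unitization.sndHom ℂ ℂ A, Unitization.continuous_snd⟩
  let L := S ∘L ContinuousLinearMap.mul ℂ (Unitization ℂ A) (a : Unitization ℂ A)
  let R := S ∘L (ContinuousLinearMap.mul ℂ (Unitization ℂ A)).flip (c : Unitization ℂ A)
  have hL : ∀ x, L x = ((a : Unitization ℂ A) * x).snd := fun _ => rfl
  have hR : ∀ x, R x = (x * (c : Unitization ℂ A)).snd := fun _ => rfl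
  have key := apply_one_eq (B.bilinearComp L R) (fun x y hxy => ?_) (b : Unitization ℂ A)
  · simpa [ContinuousLinearMap.bilinearComp_apply, hL, hR] using key
  · rw [ContinuousLinearMap.bilinearComp_apply]
    refine hB _ _ ?_
    have h : ((a : Unitization ℂ A) * x) * (y * (c : Unitization ℂ A)) = 0 := by
      rw [mul_assoc, ← mul_assoc x, hxy, zero_mul, mul_zero]
    have h2 := congrArg (fun z => z.snd) h
    rw [hL, hR]
    simpa using h2

open Filter Topology

/-! ### Approximate units -/

theorem exists_approximateUnit (A : Type*) [NonUnitalCStarAlgebra A] :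
    ∃ l : Filter A, l.NeBot ∧ (∀ᶠ e in l, ‖e‖ ≤ 1) ∧ (∀ a, Tendsto (fun e => a * e) l (𝓝 a)) ∧
      ∀ a, Tendsto (fun e => e * a) l (𝓝 a) := by
  let _ := CStarAlgebra.spectralOrder A
  have _ := CStarAlgebra.spectralOrderedRing A
  have h := CStarAlgebra.increasingApproximateUnit A
  exact ⟨CStarAlgebra.approximateUnit A, inferInstance, h.eventually_norm, h.tendsto_mul_left,
    h.tendsto_mul_right⟩

/-! ### Algebraic identities characterising the preservers -/

section Identities

variable {A : Type u} {B : Type v} [NonUnitalCStarAlgebra A] [NonUnitalCStarAlgebra B]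

theorem PreservesZeroProducts.map_mul_mul_map {φ : A →L[ℂ] B} (h : PreservesZeroProducts φ)
    (a b c : A) : φ (a * b) * φ c = φ a * φ (b * c) :=
  apply_mul_eq_apply_mul ((ContinuousLinearMap.mul ℂ B).bilinearComp φ φ) h a b c

theorem preservesZeroProducts_of_map_mul_mul_map {φ : A →L[ℂ] B}
    (h : ∀ a b c, φ (a * b) * φ c = φ a * φ (b * c)) : PreservesZeroProducts φ := by
  intro a b hab
  obtain ⟨l, _, -, -, hl⟩ := exists_approximateUnit A
  refine tendsto_nhds_unique (((φ.continuous.tendsto a).comp (hl a)).mul_const (φ b)) ?_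
  refine tendsto_const_nhds.congr fun e => ?_
  rw [Function.comp_apply, h, hab, map_zero, mul_zero]

/-- The bounded linear map `a ↦ φ(a⋆)⋆`. -/
def ContinuousLinearMap.starConj (φ : A →L[ℂ] B) : A →L[ℂ] B where
  toFun a := star (φ (star a))
  map_add' x y := by simp
  map_smul' c x := by simp
  cont := by fun_prop

theorem ContinuousLinearMap.starConj_apply (φ : A →L[ℂ] B) (a : A) :
    φ.starConj a = star (φ (star a)) := rfl

theorem ContinuousLinearMap.starConj_starConj (φ : A →L[ℂ] B) : φ.starConj.starConj = φ := by
  ext a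
  simp only [starConj_apply, star_star]

theorem PreservesRangeOrthogonality.star_map_mul_mul_map {φ : A →L[ℂ] B}
    (h : PreservesRangeOrthogonality φ) (a b c : A) :
    star (φ (c * a)) * φ b = star (φ a) * φ (star c * b) := by
  have key := apply_mul_eq_apply_mul ((ContinuousLinearMap.mul ℂ B).bilinearComp φ.starConj φ)
    (fun x y hxy => h (star x) y (by rwa [star_star])) (star a) (star c) b
  simpa [ContinuousLinearMap.bilinearComp_apply, ContinuousLinearMap.starConj_apply] using key

theorem preservesRangeOrthogonality_of_star_map_mul_mul_map {φ : A →L[ℂ] B}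
    (h : ∀ a b c, star (φ (c * a)) * φ b = star (φ a) * φ (star c * b)) :
    PreservesRangeOrthogonality φ := by
  intro a b hab
  obtain ⟨l, _, -, hl, -⟩ := exists_approximateUnit A
  refine tendsto_nhds_unique (((φ.continuous.tendsto a).comp (hl a)).star.mul_const (φ b)) ?_
  refine tendsto_const_nhds.congr fun e => ?_
  rw [Function.comp_apply, h, hab, map_zero, mul_zero]

theorem preservesDomainOrthogonality_iff_starConj {φ : A →L[ℂ] B} :
    PreservesDomainOrthogonality φ ↔ PreservesRangeOrthogonality φ.starConj := by
  refine ⟨fun h a b hab => ?_, fun h a b hab => ?_⟩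
  · simpa [ContinuousLinearMap.starConj_apply] using h (star a) (star b) (by simpa using hab)
  · simpa [ContinuousLinearMap.starConj_apply] using h (star a) (star b) (by simpa using hab)

/-- By the C⋆-identity it suffices to kill `φ(b)⋆ φ(a) φ(a)⋆ φ(b)`, which contains the image of the
zero TRO product `a a⋆ b`. -/
theorem PreservesZeroTROProducts.preservesRangeOrthogonality {φ : A →L[ℂ] B}
    (h : PreservesZeroTROProducts φ) : PreservesRangeOrthogonality φ := by
  intro a b hab
  rw [← CStarRing.star_mul_self_eq_zero_iff, star_mul, star_star, mul_assoc, ← mul_assoc (φ a),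
    h a a b (by rw [mul_assoc, hab, mul_zero]), mul_zero]

theorem PreservesZeroTROProducts.preservesDomainOrthogonality {φ : A →L[ℂ] B}
    (h : PreservesZeroTROProducts φ) : PreservesDomainOrthogonality φ := by
  intro a b hab
  rw [← CStarRing.mul_star_self_eq_zero_iff, star_mul, star_star, ← mul_assoc,
    h a b b (by rw [hab, zero_mul]), zero_mul]

/-- The identity for domain-orthogonality gives `φ(e a) φ(b)⋆ = φ(e) φ(b a⋆)⋆`. Since `(b a⋆)⋆ c = a
b⋆ c = 0`, range-orthogonality annihilates the product with `φ(c)`; then `e` runs through an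
approximate unit. -/
theorem PreservesRangeOrthogonality.preservesZeroTROProducts {φ : A →L[ℂ] B}
    (h : PreservesRangeOrthogonality φ) (h' : PreservesDomainOrthogonality φ) :
    PreservesZeroTROProducts φ := by
  intro a b c habc
  obtain ⟨l, _, -, -, hl⟩ := exists_approximateUnit A
  refine tendsto_nhds_unique ((((φ.continuous.tendsto a).comp (hl a)).mul_const
    (star (φ b))).mul_const (φ c)) ?_
  refine tendsto_const_nhds.congr fun e => ?_
  have key := (preservesDomainOrthogonality_iff_starConj.1 h').star_map_mul_mul_map
    (star e) (star b) (star a)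
  simp only [ContinuousLinearMap.starConj_apply, star_star, star_mul] at key
  rw [Function.comp_apply, key, mul_assoc, h (b * star a) c (by simpa using habc), mul_zero]

end Identities

/-! ### Tensor product maps between completions in C⋆-seminorms -/

namespace CStarSeminorm

section Basic

variable {T : Type u} [NonUnitalRing T] [StarRing T] [Module ℂ T] (p : CStarSeminorm T)

/-- The canonical linear map from `T` to the completion. -/
def toAlgₗ : T →ₗ[ℂ] p.Alg where
  toFun := p.toAlg
  map_add' := p.toAlg_add
  map_smul' := p.toAlg_smul

theorem toAlgₗ_apply (x : T) : p.toAlgₗ x = p.toAlg x := rfl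

theorem denseRange_toAlgₗ : DenseRange p.toAlgₗ := p.isDenseInducing_toAlg.dense

end Basic

variable {A B C D : Type u} [NonUnitalCStarAlgebra A] [NonUnitalCStarAlgebra B]
  [NonUnitalCStarAlgebra C] [NonUnitalCStarAlgebra D]
  {p : CStarSeminorm (A ⊗[ℂ] C)} {q : CStarSeminorm (B ⊗[ℂ] D)}
  {φ : A →L[ℂ] B} {ψ : C →L[ℂ] D} {α : p.Alg →L[ℂ] q.Alg}

@[elab_as_elim]
theorem alg_tmul_induction {P : p.Alg → Prop} (x : p.Alg) (hP : IsClosed {x | P x})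
    (hadd : ∀ x y, P x → P y → P (x + y)) (htmul : ∀ a c, P (p.toAlg (a ⊗ₜ[ℂ] c))) : P x := by
  refine p.alg_induction x hP fun x => ?_
  induction x using TensorProduct.induction_on with
  | zero => simpa using htmul 0 0
  | tmul a c => exact htmul a c
  | add x y hx hy => rw [toAlg_add]; exact hadd _ _ hx hy

theorem tensorMap_unique {α' : p.Alg →L[ℂ] q.Alg}
    (hα : ∀ a c, α (p.toAlg (a ⊗ₜ[ℂ] c)) = q.toAlg (φ a ⊗ₜ[ℂ] ψ c))
    (hα' : ∀ a c, α' (p.toAlg (a ⊗ₜ[ℂ] c)) = q.toAlg (φ a ⊗ₜ[ℂ] ψ c)) : α' = α := by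
  ext x
  refine alg_tmul_induction x (isClosed_eq α'.continuous α.continuous) ?_ ?_
  · intro x y hx hy
    rw [map_add, map_add, hx, hy]
  · intro a c
    rw [hα, hα']

theorem existsUnique_tensorMap {K : ℝ}
    (hK : ∀ x, q (TensorProduct.map φ.toLinearMap ψ.toLinearMap x) ≤ K * p x) :
    ∃! α : p.Alg →L[ℂ] q.Alg, ∀ a c, α (p.toAlg (a ⊗ₜ[ℂ] c)) = q.toAlg (φ a ⊗ₜ[ℂ] ψ c) := by
  refine existsUnique_of_exists_of_unique
    ⟨(q.toAlgₗ ∘ₗ TensorProduct.map φ.toLinearMap ψ.toLinearMap).extendOfNorm p.toAlgₗ,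
      fun a c => ?_⟩ fun α α' h h' => tensorMap_unique h' h
  -- `extendOfNorm` can be formed without any estimate; the bound `hK` enters only here, to show
  -- that it does extend the given map.
  rw [← toAlgₗ_apply, LinearMap.extendOfNorm_eq p.denseRange_toAlgₗ ⟨K, fun x => ?_⟩]
  · rfl
  · rw [LinearMap.comp_apply, toAlgₗ_apply, toAlgₗ_apply, norm_toAlg, norm_toAlg]
    exact hK x

/-- The equivalent identity is additive and continuous in each of `x`, `y`, `z`, so it need only be
checked on elementary tensors, where it is the product of the identities for φ and ψ. -/
theorem preservesZeroProducts_tensorMap (hφ : PreservesZeroProducts φ)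
    (hψ : PreservesZeroProducts ψ)
    (hα : ∀ a c, α (p.toAlg (a ⊗ₜ[ℂ] c)) = q.toAlg (φ a ⊗ₜ[ℂ] ψ c)) :
    PreservesZeroProducts α := by
  refine preservesZeroProducts_of_map_mul_mul_map fun x y z => ?_
  refine alg_tmul_induction x (isClosed_eq (by fun_prop) (by fun_prop))
    (fun _ _ h h' => by simp only [add_mul, map_add, h, h']) fun a c => ?_
  refine alg_tmul_induction y (isClosed_eq (by fun_prop) (by fun_prop))
    (fun _ _ h h' => by simp only [add_mul, mul_add, map_add, h, h']) fun a' c' => ?_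
  refine alg_tmul_induction z (isClosed_eq (by fun_prop) (by fun_prop))
    (fun _ _ h h' => by simp only [mul_add, map_add, h, h']) fun a'' c'' => ?_
  simp only [← toAlg_mul, Algebra.TensorProduct.tmul_mul_tmul, hα, hφ.map_mul_mul_map,
    hψ.map_mul_mul_map]

theorem preservesRangeOrthogonality_tensorMap (hφ : PreservesRangeOrthogonality φ)
    (hψ : PreservesRangeOrthogonality ψ)
    (hα : ∀ a c, α (p.toAlg (a ⊗ₜ[ℂ] c)) = q.toAlg (φ a ⊗ₜ[ℂ] ψ c)) :
    PreservesRangeOrthogonality α := by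
  refine preservesRangeOrthogonality_of_star_map_mul_mul_map fun x y z => ?_
  refine alg_tmul_induction x (isClosed_eq (by fun_prop) (by fun_prop))
    (fun _ _ h h' => by simp only [add_mul, mul_add, star_add, map_add, h, h']) fun a c => ?_
  refine alg_tmul_induction y (isClosed_eq (by fun_prop) (by fun_prop))
    (fun _ _ h h' => by simp only [mul_add, map_add, h, h']) fun a' c' => ?_
  refine alg_tmul_induction z (isClosed_eq (by fun_prop) (by fun_prop))
    (fun _ _ h h' => by simp only [add_mul, mul_add, star_add, map_add, h, h']) fun a'' c'' => ?_
  simp only [← toAlg_mul, ← toAlg_star, TensorProduct.star_tmul,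
    Algebra.TensorProduct.tmul_mul_tmul, hα, hφ.star_map_mul_mul_map, hψ.star_map_mul_mul_map]

theorem starConj_tensorMap
    (hα : ∀ a c, α (p.toAlg (a ⊗ₜ[ℂ] c)) = q.toAlg (φ a ⊗ₜ[ℂ] ψ c)) (a : A) (c : C) :
    α.starConj (p.toAlg (a ⊗ₜ[ℂ] c)) = q.toAlg (φ.starConj a ⊗ₜ[ℂ] ψ.starConj c) := by
  simp only [ContinuousLinearMap.starConj_apply, ← toAlg_star, TensorProduct.star_tmul, hα]

theorem preservesDomainOrthogonality_tensorMap (hφ : PreservesDomainOrthogonality φ)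
    (hψ : PreservesDomainOrthogonality ψ)
    (hα : ∀ a c, α (p.toAlg (a ⊗ₜ[ℂ] c)) = q.toAlg (φ a ⊗ₜ[ℂ] ψ c)) :
    PreservesDomainOrthogonality α := by
  rw [preservesDomainOrthogonality_iff_starConj] at *
  exact preservesRangeOrthogonality_tensorMap hφ hψ (starConj_tensorMap hα)

theorem preservesZeroTROProducts_tensorMap (hφ : PreservesZeroTROProducts φ)
    (hψ : PreservesZeroTROProducts ψ)
    (hα : ∀ a c, α (p.toAlg (a ⊗ₜ[ℂ] c)) = q.toAlg (φ a ⊗ₜ[ℂ] ψ c)) :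
    PreservesZeroTROProducts α :=
  (preservesRangeOrthogonality_tensorMap hφ.preservesRangeOrthogonality
    hψ.preservesRangeOrthogonality hα).preservesZeroTROProducts
    (preservesDomainOrthogonality_tensorMap hφ.preservesDomainOrthogonality
      hψ.preservesDomainOrthogonality hα)

/-- The four statements about tensor product maps between completions in C⋆-seminorms follow from
the existence of tensor product maps of range-orthogonality preservers. -/
theorem tensorMap_preservers (p : CStarSeminorm (A ⊗[ℂ] C)) (q : CStarSeminorm (B ⊗[ℂ] D))
    (φ : A →L[ℂ] B) (ψ : C →L[ℂ] D)
    (H : ∀ (φ : A →L[ℂ] B) (ψ : C →L[ℂ] D), PreservesRangeOrthogonality φ →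
      PreservesRangeOrthogonality ψ → ∃ K : ℝ, ∀ x,
        q (TensorProduct.map φ.toLinearMap ψ.toLinearMap x) ≤ K * p x) :
    (PreservesZeroProducts φ → PreservesZeroProducts ψ →
        ∀ α : p.Alg →L[ℂ] q.Alg,
          (∀ a c, α (p.toAlg (a ⊗ₜ[ℂ] c)) = q.toAlg (φ a ⊗ₜ[ℂ] ψ c)) →
          PreservesZeroProducts α) ∧
      (PreservesRangeOrthogonality φ → PreservesRangeOrthogonality ψ →
        (∃! α : p.Alg →L[ℂ] q.Alg,
          ∀ a c, α (p.toAlg (a ⊗ₜ[ℂ] c)) = q.toAlg (φ a ⊗ₜ[ℂ] ψ c)) ∧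
        ∀ α : p.Alg →L[ℂ] q.Alg,
          (∀ a c, α (p.toAlg (a ⊗ₜ[ℂ] c)) = q.toAlg (φ a ⊗ₜ[ℂ] ψ c)) →
          PreservesRangeOrthogonality α) ∧
      (PreservesDomainOrthogonality φ → PreservesDomainOrthogonality ψ →
        (∃! α : p.Alg →L[ℂ] q.Alg,
          ∀ a c, α (p.toAlg (a ⊗ₜ[ℂ] c)) = q.toAlg (φ a ⊗ₜ[ℂ] ψ c)) ∧
        ∀ α : p.Alg →L[ℂ] q.Alg,
          (∀ a c, α (p.toAlg (a ⊗ₜ[ℂ] c)) = q.toAlg (φ a ⊗ₜ[ℂ] ψ c)) →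
          PreservesDomainOrthogonality α) ∧
      (PreservesZeroTROProducts φ → PreservesZeroTROProducts ψ →
        (∃! α : p.Alg →L[ℂ] q.Alg,
          ∀ a c, α (p.toAlg (a ⊗ₜ[ℂ] c)) = q.toAlg (φ a ⊗ₜ[ℂ] ψ c)) ∧
        ∀ α : p.Alg →L[ℂ] q.Alg,
          (∀ a c, α (p.toAlg (a ⊗ₜ[ℂ] c)) = q.toAlg (φ a ⊗ₜ[ℂ] ψ c)) →
          PreservesZeroTROProducts α) := by
  have hR : ∀ (φ : A →L[ℂ] B) (ψ : C →L[ℂ] D), PreservesRangeOrthogonality φ →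
      PreservesRangeOrthogonality ψ → ∃! α : p.Alg →L[ℂ] q.Alg,
        ∀ a c, α (p.toAlg (a ⊗ₜ[ℂ] c)) = q.toAlg (φ a ⊗ₜ[ℂ] ψ c) := fun φ ψ hφ hψ =>
    existsUnique_tensorMap (H φ ψ hφ hψ).choose_spec
  refine ⟨fun hφ hψ α hα => preservesZeroProducts_tensorMap hφ hψ hα,
    fun hφ hψ => ⟨hR φ ψ hφ hψ, fun α hα => preservesRangeOrthogonality_tensorMap hφ hψ hα⟩,
    fun hφ hψ => ⟨?_, fun α hα => preservesDomainOrthogonality_tensorMap hφ hψ hα⟩,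
    fun hφ hψ => ⟨hR φ ψ hφ.preservesRangeOrthogonality hψ.preservesRangeOrthogonality,
      fun α hα => preservesZeroTROProducts_tensorMap hφ hψ hα⟩⟩
  -- Existence in the domain case: tensor the conjugated maps, which preserve range-orthogonality,
  -- and conjugate the result back.
  obtain ⟨α, hα, -⟩ := hR _ _ (preservesDomainOrthogonality_iff_starConj.1 hφ)
    (preservesDomainOrthogonality_iff_starConj.1 hψ)
  have hα' := starConj_tensorMap hα
  simp only [ContinuousLinearMap.starConj_starConj] at hα'
  exact ⟨α.starConj, hα', fun β hβ => tensorMap_unique hα' hβ⟩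

end CStarSeminorm

/-! ### Existence of tensor product maps: the maximal tensor product -/

/-- Iterated Cauchy–Schwarz: the recursion gives `t 0 ^ 2 ^ n * Q ≤ Q ^ 2 ^ n * t n`, and on taking
`2 ^ n`-th roots the uncontrolled constant `C` disappears in the limit. This upgrades a crude bound
to the sharp one. -/
theorem le_mul_of_sq_le_mul_succ {t : ℕ → ℝ} {Q C s : ℝ} (ht : ∀ n, 0 ≤ t n) (hQ : 0 ≤ Q)
    (hs : 0 ≤ s) (h : ∀ n, t n ^ 2 ≤ Q * t (n + 1)) (hC : ∀ n, t n ≤ C * s ^ 2 ^ n) :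
    t 0 ≤ Q * s := by
  rcases hQ.eq_or_lt with rfl | hQ
  · have := h 0
    rw [zero_mul] at this ⊢
    exact (pow_eq_zero_iff two_ne_zero).1 (le_antisymm this (sq_nonneg _)) |>.le
  have h1 : ∀ n, t 0 ^ 2 ^ n * Q ≤ Q ^ 2 ^ n * t n := by
    intro n
    induction n with
    | zero => simp [mul_comm]
    | succ n ih =>
      refine le_of_mul_le_mul_right ?_ hQ
      calc t 0 ^ 2 ^ (n + 1) * Q * Q = (t 0 ^ 2 ^ n * Q) ^ 2 := by ring
        _ ≤ (Q ^ 2 ^ n * t n) ^ 2 :=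
          pow_le_pow_left₀ (mul_nonneg (pow_nonneg (ht 0) _) hQ.le) ih 2
        _ = Q ^ 2 ^ (n + 1) * t n ^ 2 := by ring
        _ ≤ Q ^ 2 ^ (n + 1) * (Q * t (n + 1)) := by gcongr; exact h n
        _ = _ := by ring
  by_contra! hlt
  have ht0 : 0 < t 0 := lt_of_le_of_lt (by positivity) hlt
  -- If `Q * s < t 0`, the right-hand side tends to 0, contradicting `0 < Q`.
  have h2 : ∀ n : ℕ, Q ≤ C * (Q * s / t 0) ^ 2 ^ n := by
    intro n
    rw [div_pow, mul_div_assoc', le_div_iff₀ (by positivity)]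
    calc Q * t 0 ^ 2 ^ n = t 0 ^ 2 ^ n * Q := mul_comm _ _
      _ ≤ Q ^ 2 ^ n * t n := h1 n
      _ ≤ Q ^ 2 ^ n * (C * s ^ 2 ^ n) := by gcongr; exact hC n
      _ = _ := by rw [mul_pow]; ring
  have h3 : Tendsto (fun n : ℕ => C * (Q * s / t 0) ^ 2 ^ n) atTop (𝓝 (C * 0)) :=
    ((tendsto_pow_atTop_nhds_zero_of_lt_one (by positivity) ((div_lt_one ht0).2 hlt)).comp
      (tendsto_pow_atTop_atTop_of_one_lt one_lt_two)).const_mul C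
  rw [mul_zero] at h3
  exact hQ.not_ge (ge_of_tendsto' h3 h2)

theorem norm_iterate_star_mul_self {A : Type*} [NonUnitalCStarAlgebra A] (a : A) (n : ℕ) :
    ‖(fun x : A => star x * x)^[n] a‖ = ‖a‖ ^ 2 ^ n := by
  induction n with
  | zero => simp
  | succ n ih =>
    rw [Function.iterate_succ_apply', CStarRing.norm_star_mul_self, ih]
    ring

/-! ### Left multiplication on the range of the algebraic tensor map -/

section Max

variable {A B C D : Type u} [NonUnitalCStarAlgebra A] [NonUnitalCStarAlgebra B]
  [NonUnitalCStarAlgebra C] [NonUnitalCStarAlgebra D]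
  {φ : A →L[ℂ] B} {ψ : C →L[ℂ] D}

variable (φ ψ) in
/-- The algebraic tensor product of two bounded linear maps. -/
def algTensorMap : (A ⊗[ℂ] C) →ₗ[ℂ] (B ⊗[ℂ] D) :=
  TensorProduct.map φ.toLinearMap ψ.toLinearMap

theorem algTensorMap_tmul (a : A) (c : C) :
    algTensorMap φ ψ (a ⊗ₜ[ℂ] c) = φ a ⊗ₜ[ℂ] ψ c := rfl

theorem star_algTensorMap_mul_mul (hφ : PreservesRangeOrthogonality φ)
    (hψ : PreservesRangeOrthogonality ψ) (x z y : A ⊗[ℂ] C) :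
    star (algTensorMap φ ψ (y * x)) * algTensorMap φ ψ z =
      star (algTensorMap φ ψ x) * algTensorMap φ ψ (star y * z) := by
  induction x using TensorProduct.induction_on with
  | zero => simp only [mul_zero, map_zero, star_zero, zero_mul]
  | add x x' hx hx' => simp only [mul_add, map_add, star_add, add_mul, hx, hx']
  | tmul a c =>
    induction y using TensorProduct.induction_on with
    | zero => simp only [mul_zero, map_zero, star_zero, zero_mul]
    | add x x' hx hx' => simp only [mul_add, map_add, star_add, add_mul, hx, hx']
    | tmul a' c' =>
      induction z using TensorProduct.induction_on with
      | zero => simp only [mul_zero, map_zero]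
      | add x x' hx hx' => simp only [mul_add, map_add, hx, hx']
      | tmul a'' c'' =>
        simp only [TensorProduct.star_tmul, Algebra.TensorProduct.tmul_mul_tmul,
          algTensorMap_tmul, hφ.star_map_mul_mul_map, hψ.star_map_mul_mul_map]

namespace CStarSeminorm

variable (q : CStarSeminorm (B ⊗[ℂ] D))

/-- This is the Cauchy–Schwarz step: the C⋆-identity for `q`, with one factor `y` moved across the
star by the range-orthogonality identity. -/
theorem algTensorMap_mul_sq_le (hφ : PreservesRangeOrthogonality φ)
    (hψ : PreservesRangeOrthogonality ψ) (y x : A ⊗[ℂ] C) :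
    q (algTensorMap φ ψ (y * x)) ^ 2 ≤
      q (algTensorMap φ ψ x) * q (algTensorMap φ ψ (star y * y * x)) := by
  rw [← q.star_mul_self, star_algTensorMap_mul_mul hφ hψ, mul_assoc]
  exact (q.mul_le _ _).trans_eq (by rw [q.map_star])

/-- The crude bound that starts the iteration. `K` depends on `x` beyond control; only the growth in
`‖a‖ * ‖c‖` matters. -/
theorem exists_algTensorMap_tmul_mul_le (x : A ⊗[ℂ] C) :
    ∃ K, ∀ a c, q (algTensorMap φ ψ (a ⊗ₜ[ℂ] c * x)) ≤ K * (‖a‖ * ‖c‖) := by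
  induction x using TensorProduct.induction_on with
  | zero =>
    refine ⟨0, fun a c => ?_⟩
    rw [mul_zero, map_zero, zero_mul]
    exact (map_zero q.toSeminorm).le
  | add x x' hx hx' =>
    obtain ⟨K, hK⟩ := hx
    obtain ⟨K', hK'⟩ := hx'
    refine ⟨K + K', fun a c => ?_⟩
    rw [mul_add, map_add, add_mul]
    exact (q.add_le _ _).trans (add_le_add (hK a c) (hK' a c))
  | tmul a' c' =>
    refine ⟨‖φ‖ * ‖a'‖ * (‖ψ‖ * ‖c'‖), fun a c => ?_⟩
    rw [Algebra.TensorProduct.tmul_mul_tmul, algTensorMap_tmul]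
    calc q (φ (a * a') ⊗ₜ[ℂ] ψ (c * c')) ≤ ‖φ (a * a')‖ * ‖ψ (c * c')‖ := q.tmul_le _ _
      _ ≤ (‖φ‖ * (‖a‖ * ‖a'‖)) * (‖ψ‖ * (‖c‖ * ‖c'‖)) := by
        gcongr
        · exact (φ.le_opNorm _).trans (by gcongr; exact norm_mul_le _ _)
        · exact (ψ.le_opNorm _).trans (by gcongr; exact norm_mul_le _ _)
      _ = _ := by ring

/-- The iteration replaces `a` and `c` by `a⋆ a` and `c⋆ c` repeatedly; after `n` rounds the norms
are exactly `‖a‖ ^ 2 ^ n` and `‖c‖ ^ 2 ^ n`. -/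
theorem algTensorMap_tmul_mul_le (hφ : PreservesRangeOrthogonality φ)
    (hψ : PreservesRangeOrthogonality ψ) (a : A) (c : C) (x : A ⊗[ℂ] C) :
    q (algTensorMap φ ψ (a ⊗ₜ[ℂ] c * x)) ≤ q (algTensorMap φ ψ x) * (‖a‖ * ‖c‖) := by
  obtain ⟨K, hK⟩ := q.exists_algTensorMap_tmul_mul_le (φ := φ) (ψ := ψ) x
  refine le_mul_of_sq_le_mul_succ (C := K) (t := fun n => q (algTensorMap φ ψ
    (((fun x : A => star x * x)^[n] a) ⊗ₜ[ℂ] ((fun x : C => star x * x)^[n] c) * x)))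
    (fun n => q.nonneg _) (q.nonneg _) (by positivity) (fun n => ?_) fun n => ?_
  · simp only [Function.iterate_succ_apply']
    rw [← Algebra.TensorProduct.tmul_mul_tmul, ← TensorProduct.star_tmul]
    exact q.algTensorMap_mul_sq_le hφ hψ _ _
  · refine (hK _ _).trans_eq ?_
    rw [norm_iterate_star_mul_self, norm_iterate_star_mul_self, mul_pow]

theorem exists_algTensorMap_mul_le (hφ : PreservesRangeOrthogonality φ)
    (hψ : PreservesRangeOrthogonality ψ) (y : A ⊗[ℂ] C) :
    ∃ K, 0 ≤ K ∧ ∀ x, q (algTensorMap φ ψ (y * x)) ≤ K * q (algTensorMap φ ψ x) := by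
  induction y using TensorProduct.induction_on with
  | zero =>
    refine ⟨0, le_rfl, fun x => ?_⟩
    rw [zero_mul, map_zero, zero_mul]
    exact (map_zero q.toSeminorm).le
  | add y y' hy hy' =>
    obtain ⟨K, hK0, hK⟩ := hy
    obtain ⟨K', hK0', hK'⟩ := hy'
    refine ⟨K + K', by positivity, fun x => ?_⟩
    rw [add_mul, map_add, add_mul]
    exact (q.add_le _ _).trans (add_le_add (hK x) (hK' x))
  | tmul a c =>
    refine ⟨‖a‖ * ‖c‖, by positivity, fun x => ?_⟩
    rw [mul_comm]
    exact q.algTensorMap_tmul_mul_le hφ hψ a c x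

variable (φ ψ) in
/-- The best constant `K` with `q ((φ ⊗ ψ) (y x)) ≤ K q ((φ ⊗ ψ) x)` for all `x`. -/
def mulBound (y : A ⊗[ℂ] C) : ℝ :=
  ⨆ x : A ⊗[ℂ] C, q (algTensorMap φ ψ (y * x)) / q (algTensorMap φ ψ x)

theorem mulBound_nonneg (y : A ⊗[ℂ] C) : 0 ≤ q.mulBound φ ψ y :=
  Real.iSup_nonneg fun _ => div_nonneg (q.nonneg _) (q.nonneg _)

theorem mulBound_le {y : A ⊗[ℂ] C} {K : ℝ} (hK : 0 ≤ K)
    (h : ∀ x, q (algTensorMap φ ψ (y * x)) ≤ K * q (algTensorMap φ ψ x)) :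
    q.mulBound φ ψ y ≤ K :=
  Real.iSup_le (fun x => div_le_of_le_mul₀ (q.nonneg _) hK (h x)) hK

theorem algTensorMap_mul_le_mulBound (hφ : PreservesRangeOrthogonality φ)
    (hψ : PreservesRangeOrthogonality ψ) (y x : A ⊗[ℂ] C) :
    q (algTensorMap φ ψ (y * x)) ≤ q.mulBound φ ψ y * q (algTensorMap φ ψ x) := by
  obtain ⟨K, hK0, hK⟩ := q.exists_algTensorMap_mul_le hφ hψ y
  -- Where the denominator vanishes, the quotient in `mulBound` is 0 by convention, but there `hK`
  -- forces the numerator to vanish as well.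
  rcases (q.nonneg (algTensorMap φ ψ x)).eq_or_lt with h | h
  · have := hK x
    rwa [← h, mul_zero] at this ⊢
  · rw [← div_le_iff₀ h]
    refine le_ciSup (f := fun x => q (algTensorMap φ ψ (y * x)) / q (algTensorMap φ ψ x)) ?_ x
    refine ⟨K, ?_⟩
    rintro _ ⟨x, rfl⟩
    exact div_le_of_le_mul₀ (q.nonneg _) hK0 (hK x)

/-- The Cauchy–Schwarz step bounds `q (Φ (y * x)) ^ 2` by `mulBound (star y * y) * q (Φ x) ^ 2`.
This is the nontrivial half of the C⋆-identity for `mulBound`. -/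
theorem mulBound_sq_le (hφ : PreservesRangeOrthogonality φ)
    (hψ : PreservesRangeOrthogonality ψ) (y : A ⊗[ℂ] C) :
    q.mulBound φ ψ y ^ 2 ≤ q.mulBound φ ψ (star y * y) := by
  rw [← Real.le_sqrt (q.mulBound_nonneg _) (q.mulBound_nonneg _)]
  refine q.mulBound_le (Real.sqrt_nonneg _) fun x => ?_
  refine abs_le_of_sq_le_sq' ?_ (mul_nonneg (Real.sqrt_nonneg _) (q.nonneg _)) |>.2
  rw [mul_pow, Real.sq_sqrt (q.mulBound_nonneg _)]
  refine (q.algTensorMap_mul_sq_le hφ hψ y x).trans ?_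
  have := mul_le_mul_of_nonneg_left (q.algTensorMap_mul_le_mulBound hφ hψ (star y * y) x)
    (q.nonneg (algTensorMap φ ψ x))
  linarith

theorem mulBound_mul_le (hφ : PreservesRangeOrthogonality φ)
    (hψ : PreservesRangeOrthogonality ψ) (y z : A ⊗[ℂ] C) :
    q.mulBound φ ψ (y * z) ≤ q.mulBound φ ψ y * q.mulBound φ ψ z := by
  refine q.mulBound_le (mul_nonneg (q.mulBound_nonneg _) (q.mulBound_nonneg _)) fun x => ?_
  rw [mul_assoc, mul_assoc]
  exact (q.algTensorMap_mul_le_mulBound hφ hψ _ _).trans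
    (mul_le_mul_of_nonneg_left (q.algTensorMap_mul_le_mulBound hφ hψ _ _) (q.mulBound_nonneg _))

theorem mulBound_le_star (hφ : PreservesRangeOrthogonality φ)
    (hψ : PreservesRangeOrthogonality ψ) (y : A ⊗[ℂ] C) :
    q.mulBound φ ψ y ≤ q.mulBound φ ψ (star y) := by
  have h1 := q.mulBound_sq_le hφ hψ y
  have h2 := q.mulBound_mul_le hφ hψ (star y) y
  have h3 := q.mulBound_nonneg (φ := φ) (ψ := ψ) y
  have h4 := q.mulBound_nonneg (φ := φ) (ψ := ψ) (star y)
  by_contra! h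
  nlinarith

theorem mulBound_smul_le (hφ : PreservesRangeOrthogonality φ)
    (hψ : PreservesRangeOrthogonality ψ) (r : ℂ) (y : A ⊗[ℂ] C) :
    q.mulBound φ ψ (r • y) ≤ ‖r‖ * q.mulBound φ ψ y := by
  refine q.mulBound_le (mul_nonneg (norm_nonneg r) (q.mulBound_nonneg _)) fun x => ?_
  rw [smul_mul_assoc, map_smul, mul_assoc]
  refine (map_smul_eq_mul q.toSeminorm r _).trans_le ?_
  exact mul_le_mul_of_nonneg_left (q.algTensorMap_mul_le_mulBound hφ hψ _ _) (norm_nonneg r)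

/-- The norm of the left multiplication by `y` on the range of `φ ⊗ ψ` is a C⋆-seminorm. -/
def mulSeminorm (hφ : PreservesRangeOrthogonality φ) (hψ : PreservesRangeOrthogonality ψ) :
    CStarSeminorm (A ⊗[ℂ] C) where
  toSeminorm := Seminorm.ofSMulLE (q.mulBound φ ψ)
    (le_antisymm (q.mulBound_le le_rfl fun x => by
      rw [zero_mul, map_zero, zero_mul]
      exact (map_zero q.toSeminorm).le) (q.mulBound_nonneg _))
    (fun y y' => q.mulBound_le (add_nonneg (q.mulBound_nonneg _) (q.mulBound_nonneg _))
      fun x => by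
        rw [add_mul, map_add, add_mul]
        exact (q.add_le _ _).trans (add_le_add (q.algTensorMap_mul_le_mulBound hφ hψ _ _)
          (q.algTensorMap_mul_le_mulBound hφ hψ _ _)))
    (q.mulBound_smul_le hφ hψ)
  mul_le := q.mulBound_mul_le hφ hψ
  star_mul_self y := by
    refine le_antisymm ((q.mulBound_mul_le hφ hψ (star y) y).trans ?_) (q.mulBound_sq_le hφ hψ y)
    rw [pow_two]
    refine mul_le_mul_of_nonneg_right ?_ (q.mulBound_nonneg _)
    exact (q.mulBound_le_star hφ hψ (star y)).trans_eq (by rw [star_star]; rfl)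

theorem mulSeminorm_le_max (hφ : PreservesRangeOrthogonality φ)
    (hψ : PreservesRangeOrthogonality ψ) (y : A ⊗[ℂ] C) :
    q.mulBound φ ψ y ≤ maxSeminorm A C y :=
  le_ciSup (bddAbove_range Set.univ y) ⟨q.mulSeminorm hφ hψ, Set.mem_univ _⟩

/-- The bounded bilinear map `(b, d) ↦ b ⊗ d` into the completion. -/
def tmulL : B →L[ℂ] D →L[ℂ] q.Alg :=
  LinearMap.mkContinuous₂ ((TensorProduct.mk ℂ B D).compr₂ q.toAlgₗ) 1 fun b d => by
    rw [one_mul]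
    exact (q.norm_toAlg _).trans_le (q.tmul_le b d)

theorem tmulL_apply (b : B) (d : D) : q.tmulL b d = q.toAlg (b ⊗ₜ[ℂ] d) := rfl

/-- Approximate units of `A` and `C` bounded by 1 serve as `a` and `c`. The convergence after
applying φ ⊗ ψ holds because `q` is subcross, which makes `(b, d) ↦ b ⊗ d` jointly continuous. -/
theorem algTensorMap_le_of_forall_mul_tmul_le {K : ℝ} (y : A ⊗[ℂ] C)
    (h : ∀ a c, ‖a‖ ≤ 1 → ‖c‖ ≤ 1 → q (algTensorMap φ ψ (y * a ⊗ₜ[ℂ] c)) ≤ K) :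
    q (algTensorMap φ ψ y) ≤ K := by
  obtain ⟨l, _, hl1, hl, -⟩ := exists_approximateUnit A
  obtain ⟨m, _, hm1, hm, -⟩ := exists_approximateUnit C
  have key : Tendsto (fun e : A × C => q.toAlg (algTensorMap φ ψ (y * e.1 ⊗ₜ[ℂ] e.2)))
      (l ×ˢ m) (𝓝 (q.toAlg (algTensorMap φ ψ y))) := by
    clear h
    induction y using TensorProduct.induction_on with
    | zero => simpa only [zero_mul] using tendsto_const_nhds
    | add y y' hy hy' => simpa only [add_mul, map_add, toAlg_add] using hy.add hy'
    | tmul a c =>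
      simp only [Algebra.TensorProduct.tmul_mul_tmul, algTensorMap_tmul, ← tmulL_apply]
      have h1 : Tendsto (fun e : A × C => φ (a * e.1)) (l ×ˢ m) (𝓝 (φ a)) :=
        (φ.continuous.tendsto a).comp ((hl a).comp tendsto_fst)
      have h2 : Tendsto (fun e : A × C => ψ (c * e.2)) (l ×ˢ m) (𝓝 (ψ c)) :=
        (ψ.continuous.tendsto c).comp ((hm c).comp tendsto_snd)
      have h3 : Tendsto (fun e : A × C => q.tmulL (φ (a * e.1))) (l ×ˢ m) (𝓝 (q.tmulL (φ a))) :=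
        (q.tmulL.continuous.tendsto (φ a)).comp h1
      refine ((isBoundedBilinearMap_apply (𝕜 := ℂ) (E := D) (F := q.Alg)).continuous.tendsto
        (q.tmulL (φ a), ψ c)).comp (h3.prodMk_nhds h2)
  rw [← q.norm_toAlg]
  refine le_of_tendsto key.norm ?_
  filter_upwards [hl1.prod_mk hm1] with e he
  rw [q.norm_toAlg]
  exact h _ _ he.1 he.2

theorem algTensorMap_le_max (hφ : PreservesRangeOrthogonality φ)
    (hψ : PreservesRangeOrthogonality ψ) (y : A ⊗[ℂ] C) :
    q (algTensorMap φ ψ y) ≤ ‖φ‖ * ‖ψ‖ * maxSeminorm A C y := by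
  refine q.algTensorMap_le_of_forall_mul_tmul_le y fun a c ha hc => ?_
  have h0 := (maxSeminorm A C).nonneg y
  calc q (algTensorMap φ ψ (y * a ⊗ₜ[ℂ] c))
      ≤ q.mulBound φ ψ y * q (algTensorMap φ ψ (a ⊗ₜ[ℂ] c)) :=
        q.algTensorMap_mul_le_mulBound hφ hψ _ _
    _ ≤ maxSeminorm A C y * (‖φ a‖ * ‖ψ c‖) :=
        mul_le_mul (q.mulSeminorm_le_max hφ hψ y) (q.tmul_le _ _) (q.nonneg _) h0
    _ ≤ maxSeminorm A C y * (‖φ‖ * ‖ψ‖) := by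
        gcongr
        · exact φ.unit_le_opNorm a ha
        · exact ψ.unit_le_opNorm c hc
    _ = _ := by ring

end CStarSeminorm

end Max

/-! ### Existence of tensor product maps: the minimal tensor product -/

/-! ### Representations obtained from operator-valued maps -/

section Dilation

variable {A H : Type u} [NonUnitalCStarAlgebra A] [NormedAddCommGroup H] [InnerProductSpace ℂ H]

/-- The linear map `a ⊗ ξ ↦ ω(a) ξ`. -/
def actionMap (ω : A →ₗ[ℂ] (H →L[ℂ] H)) : (A ⊗[ℂ] H) →ₗ[ℂ] H :=
  TensorProduct.lift (ContinuousLinearMap.coeLM ℂ ∘ₗ ω)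

theorem actionMap_tmul (ω : A →ₗ[ℂ] (H →L[ℂ] H)) (a : A) (ξ : H) :
    actionMap ω (a ⊗ₜ[ℂ] ξ) = ω a ξ := rfl

variable (H) in
/-- Left multiplication by `c` on `A ⊗ H`. -/
def mulLeftTensor (c : A) : (A ⊗[ℂ] H) →ₗ[ℂ] (A ⊗[ℂ] H) :=
  LinearMap.rTensor H (LinearMap.mulLeft ℂ c)

theorem mulLeftTensor_tmul (c a : A) (ξ : H) :
    mulLeftTensor H c (a ⊗ₜ[ℂ] ξ) = (c * a) ⊗ₜ[ℂ] ξ := rfl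

theorem mulLeftTensor_mul (c d : A) (x : A ⊗[ℂ] H) :
    mulLeftTensor H (c * d) x = mulLeftTensor H c (mulLeftTensor H d x) := by
  induction x using TensorProduct.induction_on with
  | zero => simp only [map_zero]
  | add x y hx hy => simp only [map_add, hx, hy]
  | tmul a ξ => simp only [mulLeftTensor_tmul, mul_assoc]

theorem mulLeftTensor_add (c d : A) (x : A ⊗[ℂ] H) :
    mulLeftTensor H (c + d) x = mulLeftTensor H c x + mulLeftTensor H d x := by
  induction x using TensorProduct.induction_on with
  | zero => simp only [map_zero, add_zero]
  | add x y hx hy => simp only [map_add, hx, hy]; abel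
  | tmul a ξ => simp only [mulLeftTensor_tmul, add_mul, TensorProduct.add_tmul]

theorem mulLeftTensor_smul (r : ℂ) (d : A) (x : A ⊗[ℂ] H) :
    mulLeftTensor H (r • d) x = r • mulLeftTensor H d x := by
  induction x using TensorProduct.induction_on with
  | zero => simp only [map_zero, smul_zero]
  | add x y hx hy => simp only [map_add, hx, hy, smul_add]
  | tmul a ξ => simp only [mulLeftTensor_tmul, smul_mul_assoc, TensorProduct.smul_tmul']

variable {ω : A →ₗ[ℂ] (H →L[ℂ] H)}

theorem exists_norm_actionMap_mulLeftTensor_le {M : ℝ} (hM : ∀ a, ‖ω a‖ ≤ M * ‖a‖)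
    (x : A ⊗[ℂ] H) : ∃ K, ∀ c, ‖actionMap ω (mulLeftTensor H c x)‖ ≤ K * ‖c‖ := by
  induction x using TensorProduct.induction_on with
  | zero => exact ⟨0, fun c => by simp only [map_zero, norm_zero, zero_mul, le_refl]⟩
  | add x y hx hy =>
    obtain ⟨K, hK⟩ := hx
    obtain ⟨K', hK'⟩ := hy
    refine ⟨K + K', fun c => ?_⟩
    rw [map_add, map_add, add_mul]
    exact (norm_add_le _ _).trans (add_le_add (hK c) (hK' c))
  | tmul a ξ =>
    refine ⟨|M| * ‖a‖ * ‖ξ‖, fun c => ?_⟩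
    rw [mulLeftTensor_tmul, actionMap_tmul]
    calc ‖ω (c * a) ξ‖ ≤ ‖ω (c * a)‖ * ‖ξ‖ := (ω (c * a)).le_opNorm ξ
      _ ≤ (|M| * (‖c‖ * ‖a‖)) * ‖ξ‖ := by
        gcongr
        refine (hM _).trans (mul_le_mul (le_abs_self M) (norm_mul_le _ _) (norm_nonneg _)
          (abs_nonneg M))
      _ = _ := by ring

variable [CompleteSpace H]

/-- The hypothesis on ω says that left multiplication by `c` has left multiplication by `star c` as
formal adjoint, for the semi-inner product pulled back along `actionMap ω`. -/
theorem inner_actionMap_mulLeftTensor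
    (hω : ∀ a b c, star (ω (c * a)) * ω b = star (ω a) * ω (star c * b)) (c : A)
    (x y : A ⊗[ℂ] H) :
    inner ℂ (actionMap ω (mulLeftTensor H c x)) (actionMap ω y) =
      inner ℂ (actionMap ω x) (actionMap ω (mulLeftTensor H (star c) y)) := by
  induction x using TensorProduct.induction_on with
  | zero => simp only [map_zero, inner_zero_left]
  | add x x' hx hx' => simp only [map_add, inner_add_left, hx, hx']
  | tmul a ξ =>
    induction y using TensorProduct.induction_on with
    | zero => simp only [map_zero, inner_zero_right]
    | add y y' hy hy' => simp only [map_add, inner_add_right, hy, hy']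
    | tmul b η =>
      simp only [mulLeftTensor_tmul, actionMap_tmul]
      rw [← ContinuousLinearMap.adjoint_inner_right, ← ContinuousLinearMap.adjoint_inner_right]
      exact congrArg (fun S : H →L[ℂ] H => inner ℂ ξ (S η)) (hω a b c)

/-- In particular `ω(a) ξ ↦ ω(c a) ξ` is well defined on the span of these vectors and has norm at
most `‖c‖`. The sharp constant again comes from the Cauchy–Schwarz iteration along `c`, `c⋆ c`, and
so on. -/
theorem norm_actionMap_mulLeftTensor_le {M : ℝ} (hM : ∀ a, ‖ω a‖ ≤ M * ‖a‖)
    (hω : ∀ a b c, star (ω (c * a)) * ω b = star (ω a) * ω (star c * b)) (c : A)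
    (x : A ⊗[ℂ] H) :
    ‖actionMap ω (mulLeftTensor H c x)‖ ≤ ‖c‖ * ‖actionMap ω x‖ := by
  obtain ⟨K, hK⟩ := exists_norm_actionMap_mulLeftTensor_le hM x
  rw [mul_comm]
  refine le_mul_of_sq_le_mul_succ (C := K) (t := fun n => ‖actionMap ω
    (mulLeftTensor H ((fun x : A => star x * x)^[n] c) x)‖)
    (fun n => norm_nonneg _) (norm_nonneg _) (norm_nonneg _) (fun n => ?_) fun n => ?_
  · simp only [Function.iterate_succ_apply']
    rw [mulLeftTensor_mul, ← inner_self_eq_norm_sq (𝕜 := ℂ), inner_actionMap_mulLeftTensor hω]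
    exact (RCLike.re_le_norm _).trans (norm_inner_le_norm _ _)
  · exact (hK _).trans_eq (by rw [norm_iterate_star_mul_self])

@[elab_as_elim]
theorem range_induction {E : Type*} [AddCommGroup E] [Module ℂ E] (T : E →ₗ[ℂ] H)
    {P : H → Prop} (h : H) (hP : IsClosed {x | P x}) (hadd : ∀ x y, P x → P y → P (x + y))
    (hT : ∀ x, P (T x)) (horth : ∀ k ∈ (LinearMap.range T).topologicalClosureᗮ, P k) : P h := by
  rw [← (LinearMap.range T).topologicalClosure.starProjection_add_starProjection_orthogonal h]
  refine hadd _ _ ?_ (horth _ (Submodule.starProjection_apply_mem _ _))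
  have hmem := (LinearMap.range T).topologicalClosure.starProjection_apply_mem h
  rw [← SetLike.mem_coe, Submodule.topologicalClosure_coe] at hmem
  exact closure_minimal (by rintro _ ⟨x, rfl⟩; exact hT x) hP hmem

/-- A linear map `ω` with `ω(c a)⋆ ω(b) = ω(a)⋆ ω(c⋆ b)` intertwines left multiplication with a
representation. -/
theorem exists_rep_mul_eq {M : ℝ} (hM : ∀ a, ‖ω a‖ ≤ M * ‖a‖)
    (hω : ∀ a b c, star (ω (c * a)) * ω b = star (ω a) * ω (star c * b)) :
    ∃ π : A →⋆ₙₐ[ℂ] (H →L[ℂ] H), ∀ a b, π a * ω b = ω (a * b) := by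
  set T := actionMap ω with hT
  set V := (LinearMap.range T).topologicalClosure with hV
  have hTV : ∀ x, T x ∈ V := fun x => Submodule.le_topologicalClosure _ ⟨x, rfl⟩
  let e : (A ⊗[ℂ] H) →ₗ[ℂ] V := T.codRestrict V hTV
  have he : DenseRange e := by
    rintro ⟨v, hv⟩
    rw [closure_subtype]
    rw [hV, ← SetLike.mem_coe, Submodule.topologicalClosure_coe] at hv
    refine closure_mono ?_ hv
    rintro _ ⟨x, rfl⟩
    exact ⟨e x, ⟨x, rfl⟩, rfl⟩
  -- The multiplication operator on the closed span `V` of the vectors `ω(a) ξ`, continued by 0 on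
  -- the orthogonal complement. Algebraic identities can thus be tested on the range of `T` and on
  -- `Vᗮ` separately.
  let π₀ : A → H →L[ℂ] H := fun c =>
    (T ∘ₗ mulLeftTensor H c).extendOfNorm e ∘L V.orthogonalProjectionOnto
  have h1 : ∀ c x, π₀ c (T x) = T (mulLeftTensor H c x) := fun c x => by
    have h2 : V.orthogonalProjectionOnto (T x) = e x :=
      Submodule.orthogonalProjectionOnto_mem_subspace_eq_self (e x)
    change (T ∘ₗ mulLeftTensor H c).extendOfNorm e (V.orthogonalProjectionOnto (T x)) = _
    rw [h2, LinearMap.extendOfNorm_eq he ⟨‖c‖, norm_actionMap_mulLeftTensor_le hM hω c⟩]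
    rfl
  have h0 : ∀ c, ∀ k ∈ Vᗮ, π₀ c k = 0 := fun c k hk => by
    change (T ∘ₗ mulLeftTensor H c).extendOfNorm e (V.orthogonalProjectionOnto k) = _
    rw [Submodule.orthogonalProjectionOnto_apply_of_mem_orthogonal hk, map_zero]
  have ext : ∀ S S' : H →L[ℂ] H, (∀ x, S (T x) = S' (T x)) → (∀ k ∈ Vᗮ, S k = S' k) → S = S' :=
    fun S S' hS hS' => ContinuousLinearMap.ext fun h =>
      range_induction T h (isClosed_eq S.continuous S'.continuous)
        (fun x y hx hy => by rw [map_add, map_add, hx, hy]) hS hS'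
  -- Invariance of `V` is what makes the mixed inner products vanish when the adjoint is computed.
  have hmemV : ∀ c h, π₀ c h ∈ V := fun c h => by
    refine range_induction T h
      ((Submodule.isClosed_topologicalClosure _).preimage (π₀ c).continuous)
      (fun x y hx hy => by rw [map_add]; exact V.add_mem hx hy)
      (fun x => by rw [h1]; exact hTV _) fun k hk => by rw [h0 c k hk]; exact V.zero_mem
  refine ⟨{ toFun := π₀, map_smul' := ?_, map_zero' := ?_, map_add' := ?_, map_mul' := ?_,
            map_star' := ?_ }, ?_⟩
  · intro r a
    refine ext _ _ (fun x => ?_) fun k hk => ?_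
    · simp only [smul_apply, h1, mulLeftTensor_smul, map_smul]; rfl
    · rw [h0 _ k hk, smul_apply, h0 _ k hk, smul_zero]
  · refine ext _ _ (fun x => ?_) fun k hk => ?_
    · rw [h1, zero_apply, ← zero_smul ℂ (0 : A), mulLeftTensor_smul, zero_smul, map_zero]
    · rw [h0 _ k hk, zero_apply]
  · intro a b
    refine ext _ _ (fun x => ?_) fun k hk => ?_
    · simp only [add_apply, h1, mulLeftTensor_add, map_add]
    · rw [h0 _ k hk, add_apply, h0 _ k hk, h0 _ k hk, add_zero]
  · intro a b
    refine ext _ _ (fun x => ?_) fun k hk => ?_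
    · rw [mul_apply_eq_comp, h1, h1, h1, mulLeftTensor_mul]
    · rw [h0 _ k hk, mul_apply_eq_comp, h0 _ k hk, map_zero]
  · intro a
    refine (ContinuousLinearMap.eq_adjoint_iff _ _).2 fun x y => ?_
    refine range_induction T x (isClosed_eq (by fun_prop) (by fun_prop))
      (fun _ _ h h' => by simp only [map_add, inner_add_left, h, h']) (fun x => ?_) fun k hk => ?_
    · refine range_induction T y (isClosed_eq (by fun_prop) (by fun_prop))
        (fun _ _ h h' => by simp only [map_add, inner_add_right, h, h']) (fun y => ?_)
        fun k hk => ?_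
      · rw [h1, h1, inner_actionMap_mulLeftTensor hω, star_star]
      · rw [h0 _ k hk, inner_zero_right]
        exact Submodule.inner_right_of_mem_orthogonal (hmemV _ _) hk
    · rw [h0 _ k hk, inner_zero_left]
      exact (Submodule.inner_left_of_mem_orthogonal (hmemV _ _) hk).symm
  · intro a b
    ext ξ
    exact h1 a (b ⊗ₜ[ℂ] ξ)

end Dilation

/-! ### Comparison with the spatial seminorms -/

section Min

variable {A B C D : Type u} [NonUnitalCStarAlgebra A] [NonUnitalCStarAlgebra B]
  [NonUnitalCStarAlgebra C] [NonUnitalCStarAlgebra D]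
  {φ : A →L[ℂ] B} {ψ : C →L[ℂ] D}

theorem PreservesRangeOrthogonality.exists_rep {H : Type u} [NormedAddCommGroup H]
    [InnerProductSpace ℂ H] [CompleteSpace H] (hφ : PreservesRangeOrthogonality φ)
    (π : B →⋆ₙₐ[ℂ] (H →L[ℂ] H)) :
    ∃ π' : A →⋆ₙₐ[ℂ] (H →L[ℂ] H), ∀ a b, π' a * π (φ b) = π (φ (a * b)) := by
  let ω : A →ₗ[ℂ] (H →L[ℂ] H) :=
    { toFun := fun a => π (φ a)
      map_add' := fun a b => by rw [map_add, map_add]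
      map_smul' := fun r a => by rw [map_smul, map_smul]; rfl }
  refine exists_rep_mul_eq (ω := ω) (M := ‖φ‖) (fun a => ?_) fun a b c => ?_
  · exact (NonUnitalStarAlgHom.norm_apply_le π (φ a)).trans (φ.le_opNorm a)
  · change star (π (φ (c * a))) * π (φ b) = star (π (φ a)) * π (φ (star c * b))
    rw [← map_star, ← map_mul, hφ.star_map_mul_mul_map, map_mul, map_star]

/-- An instance of the subcross property, for the spatial seminorm of the identity representations
of the two operator algebras. -/
theorem norm_opTensor_le {H K : Type u} [NormedAddCommGroup H] [InnerProductSpace ℂ H]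
    [CompleteSpace H] [NormedAddCommGroup K] [InnerProductSpace ℂ K] [CompleteSpace K]
    (S : H →L[ℂ] H) (T : K →L[ℂ] K) : ‖opTensor S T‖ ≤ ‖S‖ * ‖T‖ := by
  have h := (spatialSeminorm (NonUnitalStarAlgHom.id ℂ (H →L[ℂ] H))
    (NonUnitalStarAlgHom.id ℂ (K →L[ℂ] K))).tmul_le S T
  change ‖tensorRep _ _ (S ⊗ₜ[ℂ] T)‖ ≤ _ at h
  rwa [tensorRep_tmul] at h

theorem norm_tensorRep_le_min {H K : Type u} [NormedAddCommGroup H] [InnerProductSpace ℂ H]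
    [CompleteSpace H] [NormedAddCommGroup K] [InnerProductSpace ℂ K] [CompleteSpace K]
    (π : A →⋆ₙₐ[ℂ] (H →L[ℂ] H)) (ρ : C →⋆ₙₐ[ℂ] (K →L[ℂ] K)) (y : A ⊗[ℂ] C) :
    ‖tensorRep π ρ y‖ ≤ minSeminorm A C y :=
  le_ciSup (CStarSeminorm.bddAbove_range
    {p | ∃ (H : Type u) (_ : NormedAddCommGroup H) (_ : InnerProductSpace ℂ H)
      (_ : CompleteSpace H) (K : Type u) (_ : NormedAddCommGroup K) (_ : InnerProductSpace ℂ K)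
      (_ : CompleteSpace K) (π : A →⋆ₙₐ[ℂ] (H →L[ℂ] H)) (ρ : C →⋆ₙₐ[ℂ] (K →L[ℂ] K)),
      p = spatialSeminorm π ρ} y)
    ⟨spatialSeminorm π ρ, H, _, _, _, K, _, _, _, π, ρ, rfl⟩

theorem spatialSeminorm_algTensorMap_le_min {H K : Type u} [NormedAddCommGroup H]
    [InnerProductSpace ℂ H] [CompleteSpace H] [NormedAddCommGroup K] [InnerProductSpace ℂ K]
    [CompleteSpace K] (hφ : PreservesRangeOrthogonality φ) (hψ : PreservesRangeOrthogonality ψ)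
    (π : B →⋆ₙₐ[ℂ] (H →L[ℂ] H)) (ρ : D →⋆ₙₐ[ℂ] (K →L[ℂ] K)) (y : A ⊗[ℂ] C) :
    spatialSeminorm π ρ (algTensorMap φ ψ y) ≤ ‖φ‖ * ‖ψ‖ * minSeminorm A C y := by
  -- Since π' and ρ' act on the same spaces `H` and `K`, no universe changes and they take part in
  -- the supremum that defines the minimal norm of `A ⊗ C`.
  obtain ⟨π', hπ'⟩ := hφ.exists_rep π
  obtain ⟨ρ', hρ'⟩ := hψ.exists_rep ρ
  refine CStarSeminorm.algTensorMap_le_of_forall_mul_tmul_le _ y fun a c ha hc => ?_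
  have key : tensorRep π ρ (algTensorMap φ ψ (y * a ⊗ₜ[ℂ] c)) =
      tensorRep π' ρ' y * opTensor (π (φ a)) (ρ (ψ c)) := by
    induction y using TensorProduct.induction_on with
    | zero => simp only [zero_mul, map_zero]
    | add y y' hy hy' => simp only [add_mul, map_add, hy, hy']
    | tmul a' c' =>
      rw [Algebra.TensorProduct.tmul_mul_tmul, algTensorMap_tmul, tensorRep_tmul, tensorRep_tmul,
        ← opTensor_mul, hπ', hρ']
  have h0 := (minSeminorm A C).nonneg y
  change ‖tensorRep π ρ (algTensorMap φ ψ (y * a ⊗ₜ[ℂ] c))‖ ≤ _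
  rw [key]
  calc ‖tensorRep π' ρ' y * opTensor (π (φ a)) (ρ (ψ c))‖
      ≤ ‖tensorRep π' ρ' y‖ * ‖opTensor (π (φ a)) (ρ (ψ c))‖ := norm_mul_le _ _
    _ ≤ minSeminorm A C y * (‖φ‖ * ‖ψ‖) := by
        refine mul_le_mul (norm_tensorRep_le_min π' ρ' y) ?_ (norm_nonneg _) h0
        refine (norm_opTensor_le _ _).trans (mul_le_mul ?_ ?_ (norm_nonneg _) (norm_nonneg _))
        · exact (NonUnitalStarAlgHom.norm_apply_le π _).trans (φ.unit_le_opNorm a ha)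
        · exact (NonUnitalStarAlgHom.norm_apply_le ρ _).trans (ψ.unit_le_opNorm c hc)
    _ = _ := by ring

theorem minSeminorm_algTensorMap_le (hφ : PreservesRangeOrthogonality φ)
    (hψ : PreservesRangeOrthogonality ψ) (y : A ⊗[ℂ] C) :
    minSeminorm B D (algTensorMap φ ψ y) ≤ ‖φ‖ * ‖ψ‖ * minSeminorm A C y := by
  refine Real.iSup_le ?_
    (mul_nonneg (mul_nonneg (norm_nonneg _) (norm_nonneg _)) ((minSeminorm A C).nonneg y))
  rintro ⟨_, H, _, _, _, K, _, _, _, π, ρ, rfl⟩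
  exact spatialSeminorm_algTensorMap_le_min hφ hψ π ρ y

end Min

end

theorem proposition2p4 {A B C D : Type u}
    [NonUnitalCStarAlgebra A] [NonUnitalCStarAlgebra B]
    [NonUnitalCStarAlgebra C] [NonUnitalCStarAlgebra D]
    (φ : A →L[ℂ] B) (ψ : C →L[ℂ] D) :
    -- minimal tensor products
    ((PreservesZeroProducts φ → PreservesZeroProducts ψ →
        ∀ α : MinTensor A C →L[ℂ] MinTensor B D, IsMinTensorMap φ ψ α →
          PreservesZeroProducts α) ∧
      (PreservesRangeOrthogonality φ → PreservesRangeOrthogonality ψ →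
        (∃! α : MinTensor A C →L[ℂ] MinTensor B D, IsMinTensorMap φ ψ α) ∧
        ∀ α : MinTensor A C →L[ℂ] MinTensor B D, IsMinTensorMap φ ψ α →
          PreservesRangeOrthogonality α) ∧
      (PreservesDomainOrthogonality φ → PreservesDomainOrthogonality ψ →
        (∃! α : MinTensor A C →L[ℂ] MinTensor B D, IsMinTensorMap φ ψ α) ∧
        ∀ α : MinTensor A C →L[ℂ] MinTensor B D, IsMinTensorMap φ ψ α →
          PreservesDomainOrthogonality α) ∧
      (PreservesZeroTROProducts φ → PreservesZeroTROProducts ψ →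
        (∃! α : MinTensor A C →L[ℂ] MinTensor B D, IsMinTensorMap φ ψ α) ∧
        ∀ α : MinTensor A C →L[ℂ] MinTensor B D, IsMinTensorMap φ ψ α →
          PreservesZeroTROProducts α)) ∧
    -- maximal tensor products
    ((PreservesZeroProducts φ → PreservesZeroProducts ψ →
        ∀ α : MaxTensor A C →L[ℂ] MaxTensor B D, IsMaxTensorMap φ ψ α →
          PreservesZeroProducts α) ∧
      (PreservesRangeOrthogonality φ → PreservesRangeOrthogonality ψ →
        (∃! α : MaxTensor A C →L[ℂ] MaxTensor B D, IsMaxTensorMap φ ψ α) ∧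
        ∀ α : MaxTensor A C →L[ℂ] MaxTensor B D, IsMaxTensorMap φ ψ α →
          PreservesRangeOrthogonality α) ∧
      (PreservesDomainOrthogonality φ → PreservesDomainOrthogonality ψ →
        (∃! α : MaxTensor A C →L[ℂ] MaxTensor B D, IsMaxTensorMap φ ψ α) ∧
        ∀ α : MaxTensor A C →L[ℂ] MaxTensor B D, IsMaxTensorMap φ ψ α →
          PreservesDomainOrthogonality α) ∧
      (PreservesZeroTROProducts φ → PreservesZeroTROProducts ψ →
        (∃! α : MaxTensor A C →L[ℂ] MaxTensor B D, IsMaxTensorMap φ ψ α) ∧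
        ∀ α : MaxTensor A C →L[ℂ] MaxTensor B D, IsMaxTensorMap φ ψ α →
          PreservesZeroTROProducts α)) := by
  -- Both tensor products are, by definition, completions in a C⋆-seminorm; only the norm estimate
  -- distinguishes the two halves.
  exact ⟨CStarSeminorm.tensorMap_preservers _ _ φ ψ fun _ _ hφ hψ =>
      ⟨_, minSeminorm_algTensorMap_le hφ hψ⟩,
    CStarSeminorm.tensorMap_preservers _ _ φ ψ fun _ _ hφ hψ =>
      ⟨_, CStarSeminorm.algTensorMap_le_max _ hφ hψ⟩⟩
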